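/- Let $N\in\mathbb N$ and let $1<p<N$, $-\infty<\mu<((N-p)/p)^p$, $0\le s<p$, $\lambda\in\mathbb R$ and $p^*(s)=(N-s)p/(N-p)$. Let $B\subset\mathbb R^N$ be an open ball of finite radius $R>0$ centred at the origin, and consider $$-\Delta_p u-\frac{\mu}{|x|^{p}}|u|^{p-2}u=\frac{|u|^{p^*(s)-2}u}{|x|^{s}}+\lambda |u|^{p-2}u\ \text{ in } B,\qquad u=0\ \text{ on }\partial B,\qquad (\ast)$$ where $\Delta_pu=\operatorname{div}(|\nabla u|^{p-2}\nabla u)$. Let $W_0^{1,p}(B)$ be the completion of $C_0^\infty(B)$ (smooth functions with compact support in $B$) in the norm $\|\nabla u\|_{L^p(B)}$, equivalently the closure of $C_0^\infty(B)$ in $W^{1,p}(B)$. A weak solution of $(\ast)$ is a function $u\in W_0^{1,p}(B)$ such that, for all $\varphi\in C_0^\infty(B)$, $$\int_B\Big(|\nabla u|^{p-2}\nabla u\cdot\nabla\varphi-\frac{\mu}{|x|^p}|u|^{p-2}u\varphi-\lambda|u|^{p-2}u\varphi\Big)dx=\int_B\frac{|u|^{p^*(s)-2}u}{|x|^s}\varphi\,dx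 .$$ It is positive if $u>0$ almost everywhere in $B$, and radial if $u(x)=f(|x|)$ for almost every $x\in B$, for some $f:\mathbb R\to\mathbb R$. If $\lambda\le 0$, then $(\ast)$ has no positive radial weak solution. If $\lambda>0$, then $(\ast)$ has at most one positive radial weak solution (any two agree almost everywhere in $B$). -/

import Mathlib

open MeasureTheory Filter Topology
open scoped ContDiff

/-- `φ ∈ C₀^∞(Ω)`: smooth with compact support contained in `Ω`. -/
def IsTestFunction {N : ℕ} (Ω : Set (EuclideanSpace ℝ (Fin N)))
    (φ : EuclideanSpace ℝ (Fin N) → ℝ) : Prop :=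
  ContDiff ℝ ∞ φ ∧ HasCompactSupport φ ∧ tsupport φ ⊆ Ω

/-- `G` is the weak gradient of `u` in `Ω`. -/
def HasWeakGradient {N : ℕ} (Ω : Set (EuclideanSpace ℝ (Fin N)))
    (u : EuclideanSpace ℝ (Fin N) → ℝ)
    (G : EuclideanSpace ℝ (Fin N) → EuclideanSpace ℝ (Fin N)) : Prop :=
  ∀ φ : EuclideanSpace ℝ (Fin N) → ℝ, IsTestFunction Ω φ →
    ∫ x in Ω, u x • gradient φ x = - ∫ x in Ω, φ x • G x

/-- `u ∈ W₀^{1,p}(Ω)` with weak gradient `G`: both `u` and `G` are in `L^p(Ω)`, and `u` is the limit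
in `W^{1,p}(Ω)` of functions in `C₀^∞(Ω)`. For bounded `Ω` this is the completion of `C₀^∞(Ω)` in
the norm `‖∇u‖_{L^p(Ω)}`, which is equivalent to the full `W^{1,p}` norm there by the Poincaré
inequality. -/
structure MemW01p {N : ℕ} (p : ℝ) (Ω : Set (EuclideanSpace ℝ (Fin N)))
    (u : EuclideanSpace ℝ (Fin N) → ℝ)
    (G : EuclideanSpace ℝ (Fin N) → EuclideanSpace ℝ (Fin N)) : Prop where
  memLp : MemLp u (ENNReal.ofReal p) (volume.restrict Ω)
  memLp_grad : MemLp G (ENNReal.ofReal p) (volume.restrict Ω)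
  hasWeakGradient : HasWeakGradient Ω u G
  approx : ∃ φ : ℕ → EuclideanSpace ℝ (Fin N) → ℝ, (∀ n, IsTestFunction Ω (φ n)) ∧
    Tendsto (fun n => eLpNorm (fun x => φ n x - u x) (ENNReal.ofReal p) (volume.restrict Ω))
      atTop (𝓝 0) ∧
    Tendsto (fun n => eLpNorm (fun x => gradient (φ n) x - G x) (ENNReal.ofReal p)
      (volume.restrict Ω)) atTop (𝓝 0)

/-- The critical Hardy–Sobolev exponent `p*(s) = (N - s) p / (N - p)`. -/
noncomputable def critExp (N : ℕ) (p s : ℝ) : ℝ := (N - s) * p / (N - p)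

/-- `u ∈ W₀^{1,p}(B)` is a weak solution of
`-Δ_p u - μ |x|^{-p} |u|^{p-2} u = |x|^{-s} |u|^{p*(s)-2} u + lam |u|^{p-2} u` in the open ball `B`
of radius `R` centred at the origin, `u = 0` on `∂B`. -/
def IsWeakSolution {N : ℕ} (p μ s lam R : ℝ) (u : EuclideanSpace ℝ (Fin N) → ℝ) : Prop :=
  ∃ G : EuclideanSpace ℝ (Fin N) → EuclideanSpace ℝ (Fin N),
    MemW01p p (Metric.ball 0 R) u G ∧
    ∀ φ : EuclideanSpace ℝ (Fin N) → ℝ, IsTestFunction (Metric.ball 0 R) φ →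
      ∫ x in Metric.ball (0 : EuclideanSpace ℝ (Fin N)) R,
          (‖G x‖ ^ (p - 2) * inner ℝ (G x) (gradient φ x)
            - μ / ‖x‖ ^ p * (|u x| ^ (p - 2) * u x) * φ x
            - lam * (|u x| ^ (p - 2) * u x) * φ x)
        = ∫ x in Metric.ball (0 : EuclideanSpace ℝ (Fin N)) R,
            |u x| ^ (critExp N p s - 2) * u x / ‖x‖ ^ s * φ x

/-- A positive radial weak solution. As elements of `W₀^{1,p}(B)` are functions up to null sets,
positivity and radial symmetry are required almost everywhere in `B`. -/
structure IsPositiveRadialSolution {N : ℕ} (p μ s lam R : ℝ)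
    (u : EuclideanSpace ℝ (Fin N) → ℝ) : Prop where
  isWeakSolution : IsWeakSolution p μ s lam R u
  pos : ∀ᵐ x ∂(volume.restrict (Metric.ball (0 : EuclideanSpace ℝ (Fin N)) R)), 0 < u x
  radial : ∃ f : ℝ → ℝ,
    ∀ᵐ x ∂(volume.restrict (Metric.ball (0 : EuclideanSpace ℝ (Fin N)) R)), u x = f ‖x‖

/-! A radial solution is studied through a planar Hamiltonian system. Write `u = f(|x|)`, `δ =
(N-p)/p`, `p' = p/(p-1)`, `q = p*(s)`, let `F = r^(N-1) |f'|^(p-2) f'` be the flux, and put `r =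
e^t`, `w = r^δ f`, `P = r^(-δ) F`, `T = log R`. The equation becomes `w' = ∂H/∂P`, `P' = -∂H/∂w` on
`(-∞, T)` with `H = |P|^p'/p' + δ w P + (μ + λ e^(pt)) w^p/p + w^q/q`. Time enters only through `λ
e^(pt)`, so `H' = λ e^(pt) w^p`, a Pohozaev identity (`EmdenFowler.hasDerivAt_energy`). The
condition `∇u ∈ L^p` says that `|P|^p'` is integrable; a Hardy-type estimate then makes `w^p`, and
hence `H`, integrable near `-∞`. Being monotone, `H` tends to `0` there. At `T` one has `w → 0`, so
`H` tends to `|L|^p'/p' ≥ 0`, where `L = lim P`.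

If `λ < 0`, then `H` decreases strictly from `0` and cannot have a nonnegative limit. If `λ = 0`,
then `H = 0` identically; this bounds `|w'|` by a multiple of `w`, so by Gronwall `w` cannot reach
`0` at `T` from a positive value.

If `λ > 0`, then `H > 0` and `w > 0`. For two solutions let `Y_i = -P_i / w_i^(p-1)` and `D = H₂ -
(w₂/w₁)^p H₁`. Where `Y₁ > Y₂`, `D` is strictly decreasing. At a point where `Y₁ = Y₂`, the
derivative of `Y₁ - Y₂` is `w₁^(q-p) - w₂^(q-p)`, while `D` has the opposite sign. Hence on a
maximal interval with `Y₁ > Y₂` one has `D ≤ 0` at the left end and `D ≥ 0` at the right end, with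
limit `0` at an end equal to `-∞` or `T`. This contradicts strict decrease (`compare_neg`,
`compare_pos`). So the slopes coincide, and the Riccati equation for them gives `w₁ = w₂`.

The system has to be extracted from the weak formulation. Along almost every ray the approximating
test functions show that `f` is a primitive vanishing at `R` (`MemW01p.exists_radial_primitive`);
integration by parts identifies the weak gradient as radial (`HasWeakGradient.eq_of_radial`); radial
test functions and du Bois-Reymond's lemma then make the flux, and afterwards `f`, classical
(`IsPositiveRadialSolution.exists_profile`). -/

/-! ### Odd powers -/

/-- The odd power `x ↦ |x|^(b-2) x`. -/
noncomputable def oddPow (b x : ℝ) : ℝ := |x| ^ (b - 2) * x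

lemma hasDerivAt_abs_rpow_div {b : ℝ} (hb : 1 < b) (x : ℝ) :
    HasDerivAt (fun x : ℝ => |x| ^ b / b) (oddPow b x) x := by
  have h := (hasDerivAt_abs_rpow x hb).div_const b
  refine h.congr_deriv ?_
  unfold oddPow
  field_simp

lemma abs_oddPow {b : ℝ} (hb : 1 < b) (x : ℝ) : |oddPow b x| = |x| ^ (b - 1) := by
  unfold oddPow
  rcases eq_or_ne x 0 with rfl | hx
  · simp [Real.zero_rpow (by linarith : b - 1 ≠ 0)]
  · have : 0 < |x| := abs_pos.2 hx
    rw [abs_mul, abs_of_nonneg (by positivity : 0 ≤ |x| ^ (b - 2)), ← Real.rpow_add_one this.ne']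
    congr 1; ring

lemma oddPow_mul_self {b : ℝ} (hb : 1 < b) (x : ℝ) : oddPow b x * x = |x| ^ b := by
  unfold oddPow
  rcases eq_or_ne x 0 with rfl | hx
  · simp [Real.zero_rpow (by linarith : b ≠ 0)]
  · have : 0 < |x| := abs_pos.2 hx
    rw [mul_assoc, ← sq, ← sq_abs x, ← Real.rpow_natCast, ← Real.rpow_add this]
    congr 1; push_cast; ring

lemma oddPow_pos {b x : ℝ} (hx : 0 < x) : 0 < oddPow b x := by
  unfold oddPow
  have : 0 < |x| := abs_pos.2 hx.ne'
  positivity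

lemma oddPow_neg (b x : ℝ) : oddPow b (-x) = - oddPow b x := by
  simp [oddPow]

lemma oddPow_zero (b : ℝ) : oddPow b 0 = 0 := by simp [oddPow]

lemma oddPow_of_nonneg {b x : ℝ} (hb : 1 < b) (hx : 0 ≤ x) : oddPow b x = x ^ (b - 1) := by
  rw [← abs_of_nonneg (a := oddPow b x), abs_oddPow hb, abs_of_nonneg hx]
  unfold oddPow; positivity

lemma oddPow_strictMono {b : ℝ} (hb : 1 < b) : StrictMono (oddPow b) := by
  have hpos : ∀ x y : ℝ, 0 ≤ x → x < y → oddPow b x < oddPow b y := by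
    intro x y hx hxy
    rw [oddPow_of_nonneg hb hx, oddPow_of_nonneg hb (hx.trans hxy.le)]
    exact Real.rpow_lt_rpow hx hxy (by linarith)
  intro x y hxy
  rcases le_or_gt 0 x with hx | hx
  · exact hpos x y hx hxy
  rcases le_or_gt y 0 with hy | hy
  · have := hpos (-y) (-x) (by linarith) (by linarith)
    rw [oddPow_neg, oddPow_neg] at this
    linarith
  · have h1 := oddPow_pos (b := b) hy
    have h2 := oddPow_pos (b := b) (neg_pos.2 hx)
    rw [oddPow_neg] at h2
    linarith

lemma continuous_oddPow {b : ℝ} (hb : 1 < b) : Continuous (oddPow b) := by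
  rw [continuous_iff_continuousAt]
  intro x
  rcases eq_or_ne x 0 with rfl | hx
  · rw [ContinuousAt, oddPow_zero]
    rw [tendsto_zero_iff_abs_tendsto_zero]
    have : (abs ∘ oddPow b) = fun x => |x| ^ (b - 1) := by
      ext x; exact abs_oddPow hb x
    rw [this]
    have hc : Continuous fun x : ℝ => |x| ^ (b - 1) :=
      continuous_abs.rpow_const fun x => Or.inr (by linarith)
    have := hc.tendsto 0
    simpa [Real.zero_rpow (by linarith : b - 1 ≠ 0)] using this
  · unfold oddPow
    have : |x| ≠ 0 := abs_ne_zero.2 hx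
    exact (continuous_abs.continuousAt.rpow_const (Or.inl this)).mul continuousAt_id

lemma oddPow_mul {b c : ℝ} (hb : 1 < b) (hc : 0 ≤ c) (x : ℝ) :
    oddPow b (c * x) = c ^ (b - 1) * oddPow b x := by
  rcases eq_or_lt_of_le hc with rfl | hc
  · simp [oddPow_zero, Real.zero_rpow (by linarith : b - 1 ≠ 0)]
  · unfold oddPow
    rw [abs_mul, abs_of_pos hc, Real.mul_rpow hc.le (abs_nonneg _),
      show b - 1 = (b - 2) + 1 by ring, Real.rpow_add_one hc.ne']
    ring

/-- For conjugate exponents the duality maps are mutually inverse; this recovers `f'` from the flux.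
-/
lemma oddPow_oddPow {b c : ℝ} (hb : 1 < b) (hbc : (b - 1) * (c - 1) = 1) (x : ℝ) :
    oddPow b (oddPow c x) = x := by
  have hc : 1 < c := by nlinarith
  have hpos : ∀ x : ℝ, 0 ≤ x → oddPow b (oddPow c x) = x := by
    intro x hx
    rw [oddPow_of_nonneg hc hx, oddPow_of_nonneg hb (by positivity), ← Real.rpow_mul hx,
      mul_comm, hbc, Real.rpow_one]
  rcases le_total 0 x with hx | hx
  · exact hpos x hx
  · have := hpos (-x) (by linarith)
    rw [oddPow_neg, oddPow_neg] at this
    linarith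

/-! ### The Emden–Fowler system and its energy -/

/-- The first order system satisfied on `(-∞, T)` by the Emden–Fowler transform `w` of a radial
solution and its flux `P`, together with the integrability and boundary behaviour inherited from
the Sobolev space. -/
structure EmdenFowler (p δ μ q lam T : ℝ) (w P : ℝ → ℝ) : Prop where
  hasDerivAt_fst : ∀ t < T, HasDerivAt w (δ * w t + oddPow (p / (p - 1)) (P t)) t
  hasDerivAt_snd : ∀ t < T, HasDerivAt P
    (-(δ * P t + (μ + lam * Real.exp (p * t)) * w t ^ (p - 1) + w t ^ (q - 1))) t
  nonneg : ∀ t < T, 0 ≤ w t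
  exists_pos : ∀ a b, a < b → b ≤ T → ∃ t ∈ Set.Ioo a b, 0 < w t
  tendsto_zero : Tendsto w (𝓝[<] T) (𝓝 0)
  exists_tendsto : ∃ L, Tendsto P (𝓝[<] T) (𝓝 L)
  integrable : IntegrableOn (fun t => |P t| ^ (p / (p - 1))) (Set.Iio T)

/-- The Hamiltonian of the Emden–Fowler system. -/
noncomputable def efEnergy (p δ μ q lam : ℝ) (w P : ℝ → ℝ) (t : ℝ) : ℝ :=
  |P t| ^ (p / (p - 1)) / (p / (p - 1)) + δ * w t * P t
    + (μ + lam * Real.exp (p * t)) * (w t ^ p / p) + w t ^ q / q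

namespace EmdenFowler

variable {p δ μ q lam T : ℝ} {w P : ℝ → ℝ}

lemma one_lt_conj (hp : 1 < p) : 1 < p / (p - 1) := by
  rw [lt_div_iff₀ (by linarith)]; linarith

/-- The system is Hamiltonian for this energy, so along a trajectory only the explicit time
dependence `lam * exp (p t)` contributes. -/
lemma hasDerivAt_energy (h : EmdenFowler p δ μ q lam T w P) (hp : 1 < p) (hq : p < q) {t : ℝ}
    (ht : t < T) :
    HasDerivAt (efEnergy p δ μ q lam w P) (lam * Real.exp (p * t) * w t ^ p) t := by
  have h1 := h.hasDerivAt_fst t ht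
  have h2 := h.hasDerivAt_snd t ht
  have hP := (hasDerivAt_abs_rpow_div (one_lt_conj hp) (P t)).comp t h2
  have hwp := (h1.rpow_const (p := p) (Or.inr hp.le)).div_const p
  have hwq := (h1.rpow_const (p := q) (Or.inr (by linarith))).div_const q
  have he : HasDerivAt (fun t => μ + lam * Real.exp (p * t)) (lam * (Real.exp (p * t) * p)) t := by
    have := (((hasDerivAt_id t).const_mul p).exp.const_mul lam).const_add μ
    simpa using this
  have := ((hP.add ((h1.const_mul δ).mul h2)).add (he.mul hwp)).add hwq
  refine this.congr_deriv ?_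
  have : p ≠ 0 := by linarith
  have : q ≠ 0 := by linarith
  field_simp
  ring

lemma monotoneOn_energy (h : EmdenFowler p δ μ q lam T w P) (hp : 1 < p) (hq : p < q)
    (hl : 0 ≤ lam) : MonotoneOn (efEnergy p δ μ q lam w P) (Set.Iio T) := by
  refine monotoneOn_of_hasDerivWithinAt_nonneg (convex_Iio T)
    (fun t ht => (h.hasDerivAt_energy hp hq ht).continuousAt.continuousWithinAt)
    (fun t ht => (h.hasDerivAt_energy hp hq (by simpa using ht)).hasDerivWithinAt) ?_
  intro t ht
  have := h.nonneg t (by simpa using ht)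
  positivity

lemma antitoneOn_energy (h : EmdenFowler p δ μ q lam T w P) (hp : 1 < p) (hq : p < q)
    (hl : lam ≤ 0) : AntitoneOn (efEnergy p δ μ q lam w P) (Set.Iio T) := by
  refine antitoneOn_of_hasDerivWithinAt_nonpos (convex_Iio T)
    (fun t ht => (h.hasDerivAt_energy hp hq ht).continuousAt.continuousWithinAt)
    (fun t ht => (h.hasDerivAt_energy hp hq (by simpa using ht)).hasDerivWithinAt) ?_
  intro t ht
  have := h.nonneg t (by simpa using ht)
  have h2 : 0 ≤ Real.exp (p * t) * w t ^ p := by positivity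
  nlinarith

lemma continuousOn_fst (h : EmdenFowler p δ μ q lam T w P) : ContinuousOn w (Set.Iio T) :=
  fun t ht => (h.hasDerivAt_fst t ht).continuousAt.continuousWithinAt

lemma continuousOn_snd (h : EmdenFowler p δ μ q lam T w P) : ContinuousOn P (Set.Iio T) :=
  fun t ht => (h.hasDerivAt_snd t ht).continuousAt.continuousWithinAt

lemma continuousOn_energy (h : EmdenFowler p δ μ q lam T w P) (hp : 1 < p) (hq : p < q) :
    ContinuousOn (efEnergy p δ μ q lam w P) (Set.Iio T) :=
  fun _ ht => (h.hasDerivAt_energy hp hq ht).continuousAt.continuousWithinAt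

/-- A consequence of Young's inequality. -/
lemma young_le (hp : 1 < p) {ε : ℝ} (hε : 0 < ε) {x : ℝ} (hx : 0 ≤ x) (y : ℝ) :
    x ^ (p - 1) * |oddPow (p / (p - 1)) y| ≤
      ε * x ^ p + ε⁻¹ ^ (p - 1) * |y| ^ (p / (p - 1)) := by
  set g := |oddPow (p / (p - 1)) y| with hg
  have hg0 : 0 ≤ g := abs_nonneg _
  have hgp : |y| ^ (p / (p - 1)) = g ^ p := by
    rw [hg, abs_oddPow (one_lt_conj hp), ← Real.rpow_mul (abs_nonneg _)]
    congr 1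
    have : p - 1 ≠ 0 := by linarith
    field_simp
    ring
  rw [hgp]
  have hmul : ∀ z : ℝ, 0 ≤ z → z ^ (p - 1) * z = z ^ p := by
    intro z hz
    rcases eq_or_lt_of_le hz with rfl | hz
    · simp [Real.zero_rpow (by linarith : p ≠ 0)]
    · rw [← Real.rpow_add_one hz.ne']; congr 1; ring
  -- Either factor of the product can be replaced by the other, according to which side of `g = ε x`
  -- the pair lies on.
  rcases le_total g (ε * x) with hc | hc
  · calc x ^ (p - 1) * g ≤ x ^ (p - 1) * (ε * x) := by gcongr
      _ = ε * x ^ p := by rw [← hmul x hx]; ring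
      _ ≤ _ := by have : 0 ≤ ε⁻¹ ^ (p - 1) * g ^ p := by positivity
                  linarith
  · have hx' : x ≤ ε⁻¹ * g := by
      rw [← div_eq_inv_mul, le_div_iff₀ hε]; linarith
    calc x ^ (p - 1) * g ≤ (ε⁻¹ * g) ^ (p - 1) * g := by
          gcongr
      _ = ε⁻¹ ^ (p - 1) * g ^ p := by
          rw [Real.mul_rpow (by positivity) hg0, ← hmul g hg0]; ring
      _ ≤ _ := by have : 0 ≤ ε * x ^ p := by positivity
                  linarith

/-- A Hardy-type estimate. Since `(w^p)' = p w^(p-1) (δ w + oddPow p' P)`, Young's inequality gives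
`(w^p)' ≥ (pδ/2) w^p - pC |P|^p'`. Integrating over `[a, b]` controls `w a` and the integral of
`w^p` by the integral of `|P|^p'`, uniformly in `a`. -/
lemma intervalIntegral_rpow_le (h : EmdenFowler p δ μ q lam T w P) (hp : 1 < p) (hδ : 0 < δ)
    {b : ℝ} (hb : b < T) : ∃ M : ℝ, 0 ≤ M ∧ ∀ a ≤ b,
      w a ^ p + p * δ / 2 * ∫ t in a..b, w t ^ p ≤ M := by
  -- The Young constant for `ε = δ / 2`, which leaves half of the drift `δ w`.
  set C := (δ / 2)⁻¹ ^ (p - 1) with hC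
  have hC0 : 0 ≤ C := by positivity
  have hI0 : 0 ≤ ∫ t in Set.Iio T, |P t| ^ (p / (p - 1)) :=
    integral_nonneg fun t => by positivity
  refine ⟨w b ^ p + p * C * ∫ t in Set.Iio T, |P t| ^ (p / (p - 1)),
    by have := h.nonneg b hb; positivity, fun a hab => ?_⟩
  have hsub : Set.uIcc a b ⊆ Set.Iio T := by
    rw [Set.uIcc_of_le hab]; exact fun x hx => lt_of_le_of_lt hx.2 hb
  have hd : ∀ t ∈ Set.uIcc a b, HasDerivAt (fun t => w t ^ p)
      ((δ * w t + oddPow (p / (p - 1)) (P t)) * p * w t ^ (p - 1)) t := fun t ht =>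
    (h.hasDerivAt_fst t (hsub ht)).rpow_const (Or.inr hp.le)
  have hwc : ContinuousOn w (Set.uIcc a b) := h.continuousOn_fst.mono hsub
  have hPc : ContinuousOn P (Set.uIcc a b) := h.continuousOn_snd.mono hsub
  have hint : IntervalIntegrable
      (fun t => (δ * w t + oddPow (p / (p - 1)) (P t)) * p * w t ^ (p - 1)) volume a b := by
    apply ContinuousOn.intervalIntegrable
    have h1 : ContinuousOn (fun t => oddPow (p / (p - 1)) (P t)) (Set.uIcc a b) :=
      (continuous_oddPow (one_lt_conj hp)).comp_continuousOn hPc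
    have h2 : ContinuousOn (fun t => w t ^ (p - 1)) (Set.uIcc a b) :=
      hwc.rpow_const fun _ _ => Or.inr (by linarith)
    exact (((continuousOn_const.mul hwc).add h1).mul continuousOn_const).mul h2
  have hftc := intervalIntegral.integral_eq_sub_of_hasDerivAt hd hint
  have hwi : IntervalIntegrable (fun t => w t ^ p) volume a b :=
    (hwc.rpow_const fun _ _ => Or.inr (by linarith)).intervalIntegrable
  have hPi : IntervalIntegrable (fun t => |P t| ^ (p / (p - 1))) volume a b :=
    (hPc.abs.rpow_const fun _ _ => Or.inr (by have := one_lt_conj hp; linarith)).intervalIntegrable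
  have hle : ∫ t in a..b, (p * δ / 2 * w t ^ p - p * C * |P t| ^ (p / (p - 1))) ≤
      w b ^ p - w a ^ p := by
    rw [← hftc]
    refine intervalIntegral.integral_mono_on hab ((hwi.const_mul _).sub (hPi.const_mul _)) hint ?_
    intro t ht
    have htT : t < T := lt_of_le_of_lt ht.2 hb
    have hw0 := h.nonneg t htT
    have hy := young_le hp (half_pos hδ) hw0 (P t)
    have hm : w t ^ (p - 1) * w t = w t ^ p := by
      rcases eq_or_lt_of_le hw0 with hz | hz
      · rw [← hz]; simp [Real.zero_rpow (by linarith : p ≠ 0)]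
      · rw [← Real.rpow_add_one hz.ne']; congr 1; ring
    have hwp : 0 ≤ w t ^ (p - 1) := by positivity
    have hab' : -(w t ^ (p - 1) * |oddPow (p / (p - 1)) (P t)|) ≤
        w t ^ (p - 1) * oddPow (p / (p - 1)) (P t) := by
      have := neg_abs_le (oddPow (p / (p - 1)) (P t))
      nlinarith
    have e : (δ * w t + oddPow (p / (p - 1)) (P t)) * p * w t ^ (p - 1) =
      p * (δ * w t ^ p + w t ^ (p - 1) * oddPow (p / (p - 1)) (P t)) := by rw [← hm]; ring
    rw [e, show p * δ / 2 * w t ^ p - p * C * |P t| ^ (p / (p - 1)) =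
      p * (δ / 2 * w t ^ p - C * |P t| ^ (p / (p - 1))) by ring]
    refine mul_le_mul_of_nonneg_left ?_ (by linarith)
    linarith
  rw [intervalIntegral.integral_sub (hwi.const_mul _) (hPi.const_mul _),
    intervalIntegral.integral_const_mul, intervalIntegral.integral_const_mul] at hle
  have hP' : ∫ t in a..b, |P t| ^ (p / (p - 1)) ≤ ∫ t in Set.Iio T, |P t| ^ (p / (p - 1)) := by
    rw [intervalIntegral.integral_of_le hab]
    refine setIntegral_mono_set h.integrable (ae_of_all _ fun t => by positivity) ?_
    exact (show Set.Ioc a b ⊆ Set.Iio T from fun x hx => lt_of_le_of_lt hx.2 hb).eventuallyLE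
  have := mul_le_mul_of_nonneg_left hP' (by positivity : 0 ≤ p * C)
  linarith

lemma exists_le (h : EmdenFowler p δ μ q lam T w P) (hp : 1 < p) (hδ : 0 < δ)
    {b : ℝ} (hb : b < T) : ∃ M : ℝ, 0 ≤ M ∧ ∀ a ≤ b, w a ≤ M := by
  obtain ⟨M, hM, hle⟩ := h.intervalIntegral_rpow_le hp hδ hb
  refine ⟨M ^ p⁻¹, by positivity, fun a ha => ?_⟩
  have hw := h.nonneg a (ha.trans_lt hb)
  rw [Real.le_rpow_inv_iff_of_pos hw hM (by linarith)]
  have : 0 ≤ ∫ t in a..b, w t ^ p := intervalIntegral.integral_nonneg ha fun t ht => by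
    have := h.nonneg t (ht.2.trans_lt hb); positivity
  have h2 : 0 ≤ p * δ / 2 * ∫ t in a..b, w t ^ p := by positivity
  linarith [hle a ha]

lemma integrableOn_rpow (h : EmdenFowler p δ μ q lam T w P) (hp : 1 < p) (hδ : 0 < δ)
    {b : ℝ} (hb : b < T) : IntegrableOn (fun t => w t ^ p) (Set.Iic b) := by
  obtain ⟨M, hM, hle⟩ := h.intervalIntegral_rpow_le hp hδ hb
  have hc : ContinuousOn (fun t => w t ^ p) (Set.Iic b) :=
    (h.continuousOn_fst.mono (Set.Iic_subset_Iio.2 hb)).rpow_const fun _ _ => Or.inr (by linarith)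
  refine integrableOn_Iic_of_intervalIntegral_norm_bounded (a := id) (l := atBot) (2 / (p * δ) * M) b ?_
    tendsto_id ?_
  · intro i
    exact ((hc.mono Set.Icc_subset_Iic_self).integrableOn_Icc).mono_set Set.Ioc_subset_Icc_self
  · filter_upwards [eventually_le_atBot b] with a ha
    have e : ∫ t in a..b, ‖w t ^ p‖ = ∫ t in a..b, w t ^ p := by
      refine intervalIntegral.integral_congr fun t ht => ?_
      rw [Set.uIcc_of_le ha] at ht
      have := h.nonneg t (ht.2.trans_lt hb)
      simp only [Real.norm_eq_abs]
      exact abs_of_nonneg (by positivity)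
    simp only [id]
    rw [e]
    have h1 := hle a ha
    have h2 : 0 ≤ w a ^ p := by have := h.nonneg a (ha.trans_lt hb); positivity
    have h3 : p * δ / 2 * ∫ t in a..b, w t ^ p ≤ M := by linarith
    have h4 : 0 < p * δ / 2 := by positivity
    calc ∫ t in a..b, w t ^ p = 2 / (p * δ) * (p * δ / 2 * ∫ t in a..b, w t ^ p) := by
          field_simp
      _ ≤ _ := by gcongr


lemma young_mul_le (hp : 1 < p) (x y : ℝ) : |x * y| ≤ |x| ^ p + |y| ^ (p / (p - 1)) := by
  have hc : p.HolderConjugate (p / (p - 1)) := Real.HolderConjugate.conjExponent hp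
  have h := Real.young_inequality |x| |y| hc
  rw [abs_abs, abs_abs, ← abs_mul] at h
  have h1 : |x| ^ p / p ≤ |x| ^ p := div_le_self (by positivity) hp.le
  have h2 : |y| ^ (p / (p - 1)) / (p / (p - 1)) ≤ |y| ^ (p / (p - 1)) :=
    div_le_self (by positivity) (one_lt_conj hp).le
  linarith

/-- Every term is at most a multiple of `w^p + |P|^p'`; for `w^q` this uses the bound `w ≤ M` in
`w^q = w^(q-p) w^p`. -/
lemma integrableOn_energy (h : EmdenFowler p δ μ q lam T w P) (hp : 1 < p) (hδ : 0 < δ)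
    (hq : p < q) {b : ℝ} (hb : b < T) :
    IntegrableOn (efEnergy p δ μ q lam w P) (Set.Iic b) := by
  obtain ⟨M, hM, hle⟩ := h.exists_le hp hδ hb
  have hw := h.integrableOn_rpow hp hδ hb
  have hP := h.integrable.mono_set (Set.Iic_subset_Iio.2 hb)
  set C := 1 + δ + |μ| + |lam| * Real.exp (p * b) + M ^ (q - p)
  refine Integrable.mono' ((hw.add hP).const_mul C) ?_ ?_
  · exact ((h.continuousOn_energy hp hq).mono (Set.Iic_subset_Iio.2 hb)).aestronglyMeasurable
      measurableSet_Iic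
  · filter_upwards [ae_restrict_mem measurableSet_Iic] with t ht
    have ht' : t ≤ b := ht
    have hw0 := h.nonneg t (ht'.trans_lt hb)
    have hwM := hle t ht'
    have hwp : 0 ≤ w t ^ p := by positivity
    have hPp : 0 ≤ |P t| ^ (p / (p - 1)) := by positivity
    have e1 : |(|P t| ^ (p / (p - 1)) / (p / (p - 1)))| ≤ |P t| ^ (p / (p - 1)) := by
      rw [abs_of_nonneg (by have := one_lt_conj hp; positivity)]
      exact div_le_self hPp (one_lt_conj hp).le
    have e2 : |δ * w t * P t| ≤ δ * (w t ^ p + |P t| ^ (p / (p - 1))) := by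
      have := young_mul_le hp (w t) (P t)
      rw [abs_of_nonneg hw0] at this
      rw [mul_assoc, abs_mul, abs_of_pos hδ]
      gcongr
    have e3 : |(μ + lam * Real.exp (p * t)) * (w t ^ p / p)| ≤
        (|μ| + |lam| * Real.exp (p * b)) * w t ^ p := by
      rw [abs_mul, abs_of_nonneg (by positivity : 0 ≤ w t ^ p / p)]
      have h1 : |μ + lam * Real.exp (p * t)| ≤ |μ| + |lam| * Real.exp (p * b) := by
        refine (abs_add_le _ _).trans ?_
        rw [abs_mul, abs_of_pos (Real.exp_pos _)]
        have : Real.exp (p * t) ≤ Real.exp (p * b) := Real.exp_le_exp.2 (by nlinarith)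
        gcongr
      have h2 : w t ^ p / p ≤ w t ^ p := div_le_self hwp hp.le
      exact mul_le_mul h1 h2 (by positivity) (by positivity)
    have e4 : |w t ^ q / q| ≤ M ^ (q - p) * w t ^ p := by
      have hq0 : 0 < q := by linarith
      rw [abs_of_nonneg (by positivity)]
      refine (div_le_self (by positivity) (by linarith)).trans ?_
      have : w t ^ q = w t ^ (q - p) * w t ^ p := by
        rw [← Real.rpow_add_of_nonneg hw0 (by linarith) (by linarith)]; congr 1; ring
      rw [this]
      gcongr
    have hM' : 0 ≤ M ^ (q - p) := by positivity
    have hl' : 0 ≤ |lam| * Real.exp (p * b) := by positivity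
    have hμ' := abs_nonneg μ
    simp only [Pi.add_apply, Real.norm_eq_abs, efEnergy]
    refine (abs_add_le _ _).trans ?_
    refine (add_le_add ((abs_add_le _ _).trans (add_le_add (abs_add_le _ _) le_rfl)) le_rfl).trans ?_
    refine (add_le_add (add_le_add (add_le_add e1 e2) e3) e4).trans ?_
    simp only [C]
    nlinarith [mul_nonneg hμ' hPp, mul_nonneg hl' hPp, mul_nonneg hM' hPp]

lemma not_integrableOn_Iic_of_le {f : ℝ → ℝ} {b c : ℝ} (hc : 0 < c) (hf : ∀ t ≤ b, c ≤ f t) :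
    ¬ IntegrableOn f (Set.Iic b) := by
  intro hi
  have : IntegrableOn (fun _ : ℝ => c) (Set.Iic b) := by
    refine Integrable.mono hi aestronglyMeasurable_const ?_
    filter_upwards [ae_restrict_mem measurableSet_Iic] with t ht
    have := hf t ht
    rw [Real.norm_eq_abs, Real.norm_eq_abs, abs_of_pos hc, abs_of_pos (by linarith)]
    exact this
  rw [integrableOn_const_iff] at this
  simp [hc.ne'] at this

/-- A monotone function has a limit at `-∞`, and integrability on a half-line leaves only the value
`0`. -/
lemma nonneg_and_tendsto_of_monotoneOn {f : ℝ → ℝ} (hf : MonotoneOn f (Set.Iio T))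
    (hi : ∀ b < T, IntegrableOn f (Set.Iic b)) :
    (∀ t < T, 0 ≤ f t) ∧ Tendsto f atBot (𝓝 0) := by
  have h0 : ∀ t < T, 0 ≤ f t := by
    intro t ht
    by_contra! hneg
    refine not_integrableOn_Iic_of_le (f := fun s => - f s) (c := - f t) (b := t) (by linarith) ?_
      (hi t ht).neg
    intro s hs
    have := hf (lt_of_le_of_lt hs ht) ht hs
    linarith
  refine ⟨h0, ?_⟩
  rw [Metric.tendsto_nhds]
  intro ε hε
  obtain ⟨t, htT, ht⟩ : ∃ t < T, f t < ε := by
    by_contra! hcon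
    exact not_integrableOn_Iic_of_le (b := T - 1) hε (fun t ht => hcon t (by linarith))
      (hi (T - 1) (by linarith))
  filter_upwards [eventually_le_atBot t] with s hs
  have h1 := hf (lt_of_le_of_lt hs htT) htT hs
  have h2 := h0 s (hs.trans_lt htT)
  rw [Real.dist_eq, sub_zero, abs_of_nonneg h2]
  linarith

lemma tendsto_energy_atBot (h : EmdenFowler p δ μ q lam T w P) (hp : 1 < p) (hδ : 0 < δ)
    (hq : p < q) : Tendsto (efEnergy p δ μ q lam w P) atBot (𝓝 0) := by
  rcases le_total 0 lam with hl | hl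
  · exact (nonneg_and_tendsto_of_monotoneOn (h.monotoneOn_energy hp hq hl)
      fun _ hb => h.integrableOn_energy hp hδ hq hb).2
  · have := (nonneg_and_tendsto_of_monotoneOn (h.antitoneOn_energy hp hq hl).neg
      fun _ hb => (h.integrableOn_energy hp hδ hq hb).neg).2
    simpa using this.neg

lemma energy_nonpos (h : EmdenFowler p δ μ q lam T w P) (hp : 1 < p) (hδ : 0 < δ)
    (hq : p < q) (hl : lam ≤ 0) {t : ℝ} (ht : t < T) : efEnergy p δ μ q lam w P t ≤ 0 := by
  have := (nonneg_and_tendsto_of_monotoneOn (h.antitoneOn_energy hp hq hl).neg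
      fun _ hb => (h.integrableOn_energy hp hδ hq hb).neg).1 t ht
  simpa using this

lemma energy_nonneg (h : EmdenFowler p δ μ q lam T w P) (hp : 1 < p) (hδ : 0 < δ)
    (hq : p < q) (hl : 0 ≤ lam) {t : ℝ} (ht : t < T) : 0 ≤ efEnergy p δ μ q lam w P t :=
  (nonneg_and_tendsto_of_monotoneOn (h.monotoneOn_energy hp hq hl)
      fun _ hb => h.integrableOn_energy hp hδ hq hb).1 t ht

/-- Equality would make the energy constant on `(a, b)`, but its derivative is positive at any point
where `w > 0`, and such a point exists in every interval. -/
lemma energy_lt_of_pos (h : EmdenFowler p δ μ q lam T w P) (hp : 1 < p) (hq : p < q)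
    (hl : 0 < lam) {a b : ℝ} (hab : a < b) (hb : b < T) :
    efEnergy p δ μ q lam w P a < efEnergy p δ μ q lam w P b := by
  have hmono := h.monotoneOn_energy hp hq hl.le
  rcases (hmono (hab.trans hb) hb hab.le).lt_or_eq with hlt | heq
  · exact hlt
  obtain ⟨t, ht, htw⟩ := h.exists_pos a b hab hb.le
  have hcst : ∀ s ∈ Set.Ioo a b, efEnergy p δ μ q lam w P s = efEnergy p δ μ q lam w P b := by
    intro s hs
    have h1 := hmono (hab.trans hb) (hs.2.trans hb) hs.1.le
    have h2 := hmono (hs.2.trans hb) hb hs.2.le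
    linarith
  have hd : HasDerivAt (efEnergy p δ μ q lam w P) 0 t :=
    (hasDerivAt_const t (efEnergy p δ μ q lam w P b)).congr_of_eventuallyEq
      (by filter_upwards [Ioo_mem_nhds ht.1 ht.2] with s hs using hcst s hs)
  have := hd.unique (h.hasDerivAt_energy hp hq (ht.2.trans hb))
  have h3 : 0 < lam * Real.exp (p * t) * w t ^ p := by positivity
  linarith

lemma energy_pos (h : EmdenFowler p δ μ q lam T w P) (hp : 1 < p) (hδ : 0 < δ)
    (hq : p < q) (hl : 0 < lam) {t : ℝ} (ht : t < T) : 0 < efEnergy p δ μ q lam w P t :=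
  (h.energy_nonneg hp hδ hq hl.le (by linarith : t - 1 < T)).trans_lt
    (h.energy_lt_of_pos hp hq hl (by linarith) ht)

lemma energy_lt_of_neg (h : EmdenFowler p δ μ q lam T w P) (hp : 1 < p) (hq : p < q)
    (hl : lam < 0) {a b : ℝ} (hab : a < b) (hb : b < T) :
    efEnergy p δ μ q lam w P b < efEnergy p δ μ q lam w P a := by
  have hmono := h.antitoneOn_energy hp hq hl.le
  rcases (hmono (hab.trans hb) hb hab.le).lt_or_eq with hlt | heq
  · exact hlt
  obtain ⟨t, ht, htw⟩ := h.exists_pos a b hab hb.le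
  have hcst : ∀ s ∈ Set.Ioo a b, efEnergy p δ μ q lam w P s = efEnergy p δ μ q lam w P b := by
    intro s hs
    have h1 := hmono (hab.trans hb) (hs.2.trans hb) hs.1.le
    have h2 := hmono (hs.2.trans hb) hb hs.2.le
    linarith
  have hd : HasDerivAt (efEnergy p δ μ q lam w P) 0 t :=
    (hasDerivAt_const t (efEnergy p δ μ q lam w P b)).congr_of_eventuallyEq
      (by filter_upwards [Ioo_mem_nhds ht.1 ht.2] with s hs using hcst s hs)
  have := hd.unique (h.hasDerivAt_energy hp hq (ht.2.trans hb))
  have h3 : 0 < -lam * Real.exp (p * t) * w t ^ p := by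
    have : 0 < -lam := by linarith
    positivity
  linarith

/-- The limit of the energy at the boundary point. -/
lemma tendsto_energy (h : EmdenFowler p δ μ q lam T w P) (hp : 1 < p) (hq : p < q) {L : ℝ}
    (hL : Tendsto P (𝓝[<] T) (𝓝 L)) :
    Tendsto (efEnergy p δ μ q lam w P) (𝓝[<] T) (𝓝 (|L| ^ (p / (p - 1)) / (p / (p - 1)))) := by
  have hw := h.tendsto_zero
  have hwp : Tendsto (fun t => w t ^ p / p) (𝓝[<] T) (𝓝 0) := by
    have := (hw.rpow_const (p := p) (Or.inr (by linarith))).div_const p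
    simpa [Real.zero_rpow (by linarith : p ≠ 0)] using this
  have hwq : Tendsto (fun t => w t ^ q / q) (𝓝[<] T) (𝓝 0) := by
    have := (hw.rpow_const (p := q) (Or.inr (by linarith))).div_const q
    simpa [Real.zero_rpow (by linarith : q ≠ 0)] using this
  have hPL : Tendsto (fun t => |P t| ^ (p / (p - 1)) / (p / (p - 1))) (𝓝[<] T)
      (𝓝 (|L| ^ (p / (p - 1)) / (p / (p - 1)))) :=
    (hL.abs.rpow_const (Or.inr (by have := one_lt_conj hp; linarith))).div_const _
  have he : Tendsto (fun t => μ + lam * Real.exp (p * t)) (𝓝[<] T)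
      (𝓝 (μ + lam * Real.exp (p * T))) :=
    (Continuous.tendsto (by fun_prop) T).mono_left nhdsWithin_le_nhds
  have := ((hPL.add ((hw.const_mul δ).mul hL)).add (he.mul hwp)).add hwq
  simp only [mul_zero, zero_mul, add_zero] at this
  exact this

/-! ### Nonexistence for `lam ≤ 0`, positivity for `lam > 0` -/

/-- The energy is nonpositive and strictly decreasing, so its limit at `T` is negative, whereas that
limit is `|L|^p'/p' ≥ 0`. -/
lemma not_of_lam_neg (h : EmdenFowler p δ μ q lam T w P) (hp : 1 < p) (hδ : 0 < δ)
    (hq : p < q) (hl : lam < 0) : False := by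
  obtain ⟨L, hL⟩ := h.exists_tendsto
  have h1 := h.tendsto_energy hp hq hL
  have h2 : ∀ᶠ t in 𝓝[<] T, efEnergy p δ μ q lam w P t ≤ efEnergy p δ μ q lam w P (T - 1) := by
    filter_upwards [Ioo_mem_nhdsLT (show T - 1 < T by linarith)] with t ht
    exact (h.energy_lt_of_neg hp hq hl ht.1 ht.2).le
  have h3 := le_of_tendsto h1 h2
  have h4 := h.energy_lt_of_neg hp hq hl (show T - 2 < T - 1 by linarith) (by linarith)
  have h5 := h.energy_nonpos hp hδ hq hl.le (show T - 2 < T by linarith)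
  have h6 : 0 ≤ |L| ^ (p / (p - 1)) / (p / (p - 1)) := by
    have := one_lt_conj hp
    positivity
  linarith

/-- If `w' ≥ -K w` on `[a, b)` and `w → 0` at `b`, then `w` is not positive at `a`. -/
lemma nonpos_of_neg_mul_le_deriv {w w' : ℝ → ℝ} {a b K : ℝ} (hab : a < b)
    (hd : ∀ t ∈ Set.Ico a b, HasDerivAt w (w' t) t) (hK : ∀ t ∈ Set.Ico a b, -(K * w t) ≤ w' t)
    (hlim : Tendsto w (𝓝[<] b) (𝓝 0)) : w a ≤ 0 := by
  -- Gronwall's argument with the integrating factor `exp (K t)`.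
  have hm : MonotoneOn (fun t => w t * Real.exp (K * t)) (Set.Ico a b) := by
    have hd' : ∀ t ∈ Set.Ico a b, HasDerivAt (fun t => w t * Real.exp (K * t))
        (w' t * Real.exp (K * t) + w t * (Real.exp (K * t) * K)) t := by
      intro t ht
      have := (hd t ht).mul (((hasDerivAt_id t).const_mul K).exp)
      exact this.congr_deriv (by simp)
    refine monotoneOn_of_hasDerivWithinAt_nonneg (convex_Ico a b)
      (fun t ht => (hd' t ht).continuousAt.continuousWithinAt)
      (fun t ht => (hd' t (interior_subset ht)).hasDerivWithinAt) ?_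
    intro t ht
    have h1 := hK t (interior_subset ht)
    have h2 := Real.exp_pos (K * t)
    nlinarith
  have hl : Tendsto (fun t => w t * Real.exp (K * t)) (𝓝[<] b) (𝓝 (0 * Real.exp (K * b))) :=
    hlim.mul ((Continuous.tendsto (by fun_prop) b).mono_left nhdsWithin_le_nhds)
  rw [zero_mul] at hl
  have := ge_of_tendsto hl (show ∀ᶠ t in 𝓝[<] b, w a * Real.exp (K * a) ≤ w t * Real.exp (K * t) by
    filter_upwards [Ioo_mem_nhdsLT hab] with t ht
    exact hm ⟨le_rfl, hab⟩ ⟨ht.1.le, ht.2⟩ ht.1.le)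
  have h2 := Real.exp_pos (K * a)
  by_contra! hc
  nlinarith [mul_pos hc h2]


/-- The energy is identically zero, and the term `|P|^p'` in it can only be balanced if `|P|^(p'-1)`
is at most a constant times `w`. Then `w' ≥ -κ w`, which prevents `w` from reaching `0` at `T` after
being positive. -/
lemma not_of_lam_zero (h : EmdenFowler p δ μ q 0 T w P) (hp : 1 < p) (hδ : 0 < δ)
    (hq : p < q) : False := by
  have hE : ∀ t < T, efEnergy p δ μ q 0 w P t = 0 := fun t ht =>
    le_antisymm (h.energy_nonpos hp hδ hq le_rfl ht) (h.energy_nonneg hp hδ hq le_rfl ht)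
  have hsmall : ∀ᶠ t in 𝓝[<] T, w t < 1 := h.tendsto_zero.eventually_lt_const one_pos
  obtain ⟨t₁, ht₁, ht₁'⟩ := (mem_nhdsLT_iff_exists_Ioo_subset' (show T - 1 < T by linarith)).1 hsmall
  obtain ⟨t₀, ht₀, hpos⟩ := h.exists_pos t₁ T ht₁ le_rfl
  -- Large enough that `(δ + |μ|) p' / κ < 1`, which closes the contradiction below.
  set κ := 1 + (δ + |μ| + 1) * (p / (p - 1)) with hκ
  have hp1 : 0 < p - 1 := by linarith
  have hμ := abs_nonneg μ
  have hκ1 : 1 ≤ κ := by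
    have : 0 ≤ (δ + |μ| + 1) * (p / (p - 1)) := by positivity
    linarith
  refine absurd (nonpos_of_neg_mul_le_deriv (K := κ) ht₀.2
    (fun t ht => h.hasDerivAt_fst t ht.2) ?_ h.tendsto_zero) (not_le.2 hpos)
  intro t ht
  have hw0 := h.nonneg t ht.2
  have hw1 : w t ≤ 1 := (ht₁' ⟨ht₀.1.trans_le ht.1, ht.2⟩ : w t < 1).le
  set n := |oddPow (p / (p - 1)) (P t)| with hn
  have hn0 : 0 ≤ n := abs_nonneg _
  have hnP : n = |P t| ^ (p / (p - 1) - 1) := abs_oddPow (one_lt_conj hp) _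
  have hPn : |P t| = n ^ (p - 1) := by
    rw [hnP, ← Real.rpow_mul (abs_nonneg _)]
    have : (p / (p - 1) - 1) * (p - 1) = 1 := by field_simp; ring
    rw [this, Real.rpow_one]
  have hPn' : |P t| ^ (p / (p - 1)) = n ^ p := by
    rw [hPn, ← Real.rpow_mul hn0]
    congr 1; field_simp
  suffices hmain : n ≤ κ * w t by
    have := neg_abs_le (oddPow (p / (p - 1)) (P t))
    nlinarith
  -- If `w < n / κ`, the terms `δ w P` and `μ w^p / p` are too small to cancel `|P|^p'/p' = n^p/p'`,
  -- and the remaining term `w^q / q` is nonnegative.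
  by_contra! hlt
  have hnpos : 0 < n := lt_of_le_of_lt (by positivity) hlt
  have hwn : w t ≤ κ⁻¹ * n := by
    rw [← div_eq_inv_mul, le_div_iff₀ (by linarith)]; linarith
  have hnp : 0 < n ^ p := by positivity
  have hwp : w t ^ p ≤ κ⁻¹ * n ^ p := by
    calc w t ^ p ≤ (κ⁻¹ * n) ^ p := by gcongr
      _ = κ⁻¹ ^ p * n ^ p := Real.mul_rpow (by positivity) hn0
      _ ≤ κ⁻¹ * n ^ p := by
        gcongr
        have := Real.rpow_le_rpow_of_exponent_ge (by positivity : 0 < κ⁻¹) (inv_le_one_of_one_le₀ hκ1)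
          hp.le
        simpa using this
  have hwq : w t ^ q ≤ w t ^ p := by
    rcases eq_or_lt_of_le hw0 with hz | hz
    · rw [← hz, Real.zero_rpow (by linarith), Real.zero_rpow (by linarith)]
    · exact Real.rpow_le_rpow_of_exponent_ge hz hw1 hq.le
  have hwq0 : 0 ≤ w t ^ q := by positivity
  have hwp0 : 0 ≤ w t ^ p := by positivity
  have hwP : -(κ⁻¹ * n ^ p) ≤ w t * P t := by
    have h1 : w t * |P t| ≤ κ⁻¹ * n ^ p := by
      rw [hPn]
      calc w t * n ^ (p - 1) ≤ κ⁻¹ * n * n ^ (p - 1) := by gcongr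
        _ = κ⁻¹ * (n ^ (p - 1) * n) := by ring
        _ = κ⁻¹ * n ^ p := by rw [← Real.rpow_add_one hnpos.ne']; simp
    have h2 := neg_abs_le (P t)
    nlinarith
  have hE0 := hE t ht.2
  unfold efEnergy at hE0
  rw [hPn'] at hE0
  have e2 : -(|μ| * (κ⁻¹ * n ^ p)) ≤ μ * (w t ^ p / p) := by
    have h1 : w t ^ p / p ≤ κ⁻¹ * n ^ p := (div_le_self hwp0 hp.le).trans hwp
    have h2 : 0 ≤ w t ^ p / p := by positivity
    have h3 := neg_abs_le μ
    nlinarith [mul_le_mul_of_nonneg_left h1 hμ]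
  have e3 : 0 ≤ w t ^ q / q := div_nonneg hwq0 (by linarith)
  have e4 : n ^ p / (p / (p - 1)) ≤ (δ + |μ|) * (κ⁻¹ * n ^ p) := by
    nlinarith
  have e5 : n ^ p ≤ (δ + |μ|) * (p / (p - 1)) * κ⁻¹ * n ^ p := by
    rw [div_le_iff₀ (by positivity)] at e4
    linarith
  have e6 : (δ + |μ|) * (p / (p - 1)) * κ⁻¹ < 1 := by
    rw [← div_eq_mul_inv, div_lt_one (by linarith), hκ]
    have : 0 < p / (p - 1) := by positivity
    linarith
  nlinarith

/-- A zero of `w ≥ 0` is a local minimum, so `w' = 0` forces `P = 0` and the energy vanishes there,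
although it is positive. This upgrades positivity on a dense set to positivity everywhere. -/
lemma pos (h : EmdenFowler p δ μ q lam T w P) (hp : 1 < p) (hδ : 0 < δ)
    (hq : p < q) (hl : 0 < lam) {t : ℝ} (ht : t < T) : 0 < w t := by
  refine lt_of_le_of_ne (h.nonneg t ht) fun h0 => ?_
  have hmin : IsLocalMin w t := by
    filter_upwards [Iio_mem_nhds ht] with s hs
    rw [← h0]; exact h.nonneg s hs
  have hd := hmin.hasDerivAt_eq_zero (h.hasDerivAt_fst t ht)
  rw [← h0, mul_zero, zero_add] at hd
  have hP : P t = 0 := by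
    have := abs_oddPow (one_lt_conj hp) (P t)
    rw [hd, abs_zero, eq_comm, Real.rpow_eq_zero (abs_nonneg _)
      (by have := one_lt_conj hp; linarith)] at this
    exact abs_eq_zero.1 this
  have hE := h.energy_pos hp hδ hq hl ht
  unfold efEnergy at hE
  have hp' := one_lt_conj hp
  rw [← h0, hP, abs_zero, Real.zero_rpow (by linarith), Real.zero_rpow (by linarith),
    Real.zero_rpow (by linarith)] at hE
  simp at hE

end EmdenFowler

/-! ### Slopes and the comparison of two solutions -/

/-- The Riccati variable `-P / w^(p-1)` of the Emden–Fowler system. -/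
noncomputable def efSlope (p : ℝ) (w P : ℝ → ℝ) (t : ℝ) : ℝ := -(P t * w t ^ (1 - p))

namespace EmdenFowler

variable {p δ μ q lam T : ℝ} {w P : ℝ → ℝ}

lemma eq_neg_slope_mul {t : ℝ} (hw : 0 < w t) : P t = w t ^ (p - 1) * -efSlope p w P t := by
  unfold efSlope
  rw [neg_neg, mul_comm, mul_assoc, ← Real.rpow_add hw]
  simp

lemma oddPow_eq_slope (hp : 1 < p) {t : ℝ} (hw : 0 < w t) :
    oddPow (p / (p - 1)) (P t) = -(w t * oddPow (p / (p - 1)) (efSlope p w P t)) := by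
  conv_lhs => rw [eq_neg_slope_mul (p := p) (P := P) hw]
  rw [oddPow_mul (one_lt_conj hp) (by positivity), oddPow_neg, ← Real.rpow_mul hw.le]
  have : (p - 1) * (p / (p - 1) - 1) = 1 := by
    have : p - 1 ≠ 0 := by linarith
    field_simp; ring
  rw [this, Real.rpow_one]; ring

/-- Apart from `w^q`, the energy is homogeneous of degree `p` under `(w, P) ↦ (c w, c^(p-1) P)`, and
the slope is invariant; factoring out `w^p` leaves `w` only in `w^(q-p)`. -/
lemma energy_eq_slope (hp : 1 < p) {t : ℝ} (hw : 0 < w t) :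
    efEnergy p δ μ q lam w P t = w t ^ p * (|efSlope p w P t| ^ (p / (p - 1)) / (p / (p - 1))
      - δ * efSlope p w P t + (μ + lam * Real.exp (p * t)) / p + w t ^ (q - p) / q) := by
  have e1 : |P t| ^ (p / (p - 1)) = w t ^ p * |efSlope p w P t| ^ (p / (p - 1)) := by
    conv_lhs => rw [eq_neg_slope_mul (p := p) (P := P) hw]
    rw [abs_mul, abs_neg, abs_of_nonneg (by positivity : 0 ≤ w t ^ (p - 1)),
      Real.mul_rpow (by positivity) (abs_nonneg _), ← Real.rpow_mul hw.le]
    congr 2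
    have : p - 1 ≠ 0 := by linarith
    field_simp
  have e2 : w t * P t = -(w t ^ p * efSlope p w P t) := by
    conv_lhs => rw [eq_neg_slope_mul (p := p) (P := P) hw]
    have : w t ^ p = w t ^ (p - 1) * w t := by rw [← Real.rpow_add_one hw.ne']; simp
    rw [this]; ring
  have e3 : w t ^ q = w t ^ p * w t ^ (q - p) := by rw [← Real.rpow_add hw]; simp
  unfold efEnergy
  rw [e1, mul_assoc δ, e2, e3]
  ring

/-- A Riccati equation in which `w` enters only through `w^(q-p)`. Two solutions with equal slopes
at a point are therefore distinguished by that term alone. -/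
lemma hasDerivAt_slope (h : EmdenFowler p δ μ q lam T w P) (hp : 1 < p) {t : ℝ} (ht : t < T)
    (hw : 0 < w t) :
    HasDerivAt (efSlope p w P) ((p - 1) * |efSlope p w P t| ^ (p / (p - 1))
      - p * δ * efSlope p w P t + (μ + lam * Real.exp (p * t)) + w t ^ (q - p)) t := by
  have h1 := ((h.hasDerivAt_snd t ht).mul
    ((h.hasDerivAt_fst t ht).rpow_const (p := 1 - p) (Or.inl hw.ne'))).neg
  refine h1.congr_deriv ?_
  rw [oddPow_eq_slope hp hw, ← oddPow_mul_self (one_lt_conj hp)]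
  set Y := efSlope p w P t with hY
  have hP : P t = w t ^ (p - 1) * -Y := eq_neg_slope_mul hw
  rw [hP]
  have a1 : w t ^ (p - 1) * w t ^ (1 - p) = 1 := by rw [← Real.rpow_add hw]; simp
  have a2 : w t ^ (q - 1) * w t ^ (1 - p) = w t ^ (q - p) := by
    rw [← Real.rpow_add hw]; congr 1; ring
  have a3 : w t ^ (p - 1) * (w t * w t ^ (1 - p - 1)) = 1 := by
    rw [mul_comm (w t), ← Real.rpow_add_one hw.ne', ← Real.rpow_add hw]; simp
  set A := w t ^ (p - 1)
  set B := w t ^ (1 - p)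
  set C := w t ^ (1 - p - 1)
  set O := oddPow (p / (p - 1)) Y
  rw [← a2]
  linear_combination (δ * Y * (-1) + (μ + lam * Real.exp (p * t))) * a1 +
    (1 - p) * Y * (δ - O) * a3

end EmdenFowler

/-- The comparison function `H₂ - (w₂ / w₁)^p H₁` of two solutions. -/
noncomputable def efCompare (p δ μ q lam : ℝ) (w₁ P₁ w₂ P₂ : ℝ → ℝ) (t : ℝ) : ℝ :=
  efEnergy p δ μ q lam w₂ P₂ t - (w₂ t / w₁ t) ^ p * efEnergy p δ μ q lam w₁ P₁ t

namespace EmdenFowler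

variable {p δ μ q lam T : ℝ} {w₁ P₁ w₂ P₂ : ℝ → ℝ}

lemma hasDerivAt_ratio (h₁ : EmdenFowler p δ μ q lam T w₁ P₁)
    (h₂ : EmdenFowler p δ μ q lam T w₂ P₂) (hp : 1 < p) {t : ℝ} (ht : t < T)
    (hw₁ : 0 < w₁ t) (hw₂ : 0 < w₂ t) :
    HasDerivAt (fun t => w₂ t / w₁ t) (w₂ t / w₁ t * (oddPow (p / (p - 1)) (efSlope p w₁ P₁ t) -
      oddPow (p / (p - 1)) (efSlope p w₂ P₂ t))) t := by
  refine ((h₂.hasDerivAt_fst t ht).div (h₁.hasDerivAt_fst t ht) hw₁.ne').congr_deriv ?_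
  rw [oddPow_eq_slope (P := P₁) hp hw₁, oddPow_eq_slope (P := P₂) hp hw₂]
  field_simp
  ring

/-- The weight `(w₂ / w₁)^p` is chosen so that the two terms `lam * exp (p t) * w^p` cancel; what
remains is the derivative of the weight times the first energy. -/
lemma hasDerivAt_compare (h₁ : EmdenFowler p δ μ q lam T w₁ P₁)
    (h₂ : EmdenFowler p δ μ q lam T w₂ P₂) (hp : 1 < p) (hq : p < q) {t : ℝ} (ht : t < T)
    (hw₁ : 0 < w₁ t) (hw₂ : 0 < w₂ t) :
    HasDerivAt (efCompare p δ μ q lam w₁ P₁ w₂ P₂)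
      (-(p * (w₂ t / w₁ t) ^ p * (oddPow (p / (p - 1)) (efSlope p w₁ P₁ t) -
      oddPow (p / (p - 1)) (efSlope p w₂ P₂ t)) * efEnergy p δ μ q lam w₁ P₁ t)) t := by
  have hr : 0 < w₂ t / w₁ t := div_pos hw₂ hw₁
  refine ((h₂.hasDerivAt_energy hp hq ht).sub
    (((hasDerivAt_ratio h₁ h₂ hp ht hw₁ hw₂).rpow_const (p := p) (Or.inr hp.le)).mul
      (h₁.hasDerivAt_energy hp hq ht))).congr_deriv ?_
  have e1 : w₂ t ^ p = (w₂ t / w₁ t) ^ p * w₁ t ^ p := by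
    rw [← Real.mul_rpow hr.le hw₁.le, div_mul_cancel₀ _ hw₁.ne']
  have e2 : (w₂ t / w₁ t) ^ p = (w₂ t / w₁ t) ^ (p - 1) * (w₂ t / w₁ t) := by
    rw [← Real.rpow_add_one hr.ne']; simp
  rw [e1, e2]
  ring

/-- With equal slopes, all terms of the energies of degree `p` cancel under the weight `(w₂ /
w₁)^p`, leaving the difference of the `w^(q-p)` terms. -/
lemma compare_eq (hp : 1 < p) {t : ℝ} (hw₁ : 0 < w₁ t) (hw₂ : 0 < w₂ t)
    (hY : efSlope p w₁ P₁ t = efSlope p w₂ P₂ t) :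
    efCompare p δ μ q lam w₁ P₁ w₂ P₂ t =
      w₂ t ^ p * (w₂ t ^ (q - p) - w₁ t ^ (q - p)) / q := by
  have e1 : w₂ t ^ p = (w₂ t / w₁ t) ^ p * w₁ t ^ p := by
    rw [← Real.mul_rpow (by positivity) hw₁.le, div_mul_cancel₀ _ hw₁.ne']
  unfold efCompare
  rw [energy_eq_slope hp hw₁, energy_eq_slope hp hw₂, hY, ← mul_assoc, ← e1]
  ring

/-- `w₂ / w₁` is strictly increasing and the comparison function strictly decreasing where
the slope of the first solution is the larger one. -/
lemma strictAntiOn_compare (h₁ : EmdenFowler p δ μ q lam T w₁ P₁)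
    (h₂ : EmdenFowler p δ μ q lam T w₂ P₂) (hp : 1 < p) (hδ : 0 < δ) (hq : p < q) (hl : 0 < lam)
    {s : Set ℝ} (hs : Convex ℝ s) (hsT : s ⊆ Set.Iio T)
    (hY : ∀ t ∈ interior s, efSlope p w₂ P₂ t < efSlope p w₁ P₁ t) :
    StrictAntiOn (efCompare p δ μ q lam w₁ P₁ w₂ P₂) s := by
  have hd := fun t (ht : t < T) => hasDerivAt_compare h₁ h₂ hp hq ht
    (h₁.pos hp hδ hq hl ht) (h₂.pos hp hδ hq hl ht)
  refine strictAntiOn_of_hasDerivWithinAt_neg hs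
    (fun t ht => (hd t (hsT ht)).continuousAt.continuousWithinAt)
    (fun t ht => (hd t (hsT (interior_subset ht))).hasDerivWithinAt) ?_
  intro t ht
  have htT := hsT (interior_subset ht)
  have h1 := h₁.pos hp hδ hq hl htT
  have h2 := h₂.pos hp hδ hq hl htT
  have h3 := h₁.energy_pos hp hδ hq hl htT
  have h4 := sub_pos.2 (oddPow_strictMono (one_lt_conj hp) (hY t ht))
  have : 0 < p * (w₂ t / w₁ t) ^ p * (oddPow (p / (p - 1)) (efSlope p w₁ P₁ t) -
      oddPow (p / (p - 1)) (efSlope p w₂ P₂ t)) * efEnergy p δ μ q lam w₁ P₁ t := by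
    positivity
  linarith

lemma hasDerivAt_slope_sub (h₁ : EmdenFowler p δ μ q lam T w₁ P₁)
    (h₂ : EmdenFowler p δ μ q lam T w₂ P₂) (hp : 1 < p) {t : ℝ} (ht : t < T)
    (hw₁ : 0 < w₁ t) (hw₂ : 0 < w₂ t) (hY : efSlope p w₁ P₁ t = efSlope p w₂ P₂ t) :
    HasDerivAt (fun t => efSlope p w₁ P₁ t - efSlope p w₂ P₂ t)
      (w₁ t ^ (q - p) - w₂ t ^ (q - p)) t := by
  refine ((h₁.hasDerivAt_slope hp ht hw₁).sub (h₂.hasDerivAt_slope hp ht hw₂)).congr_deriv ?_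
  rw [hY]; ring

lemma continuousOn_slope_sub (h₁ : EmdenFowler p δ μ q lam T w₁ P₁)
    (h₂ : EmdenFowler p δ μ q lam T w₂ P₂) (hp : 1 < p) (hδ : 0 < δ) (hq : p < q) (hl : 0 < lam) :
    ContinuousOn (fun t => efSlope p w₁ P₁ t - efSlope p w₂ P₂ t) (Set.Iio T) := fun _ ht =>
  ((h₁.hasDerivAt_slope hp ht (h₁.pos hp hδ hq hl ht)).sub
    (h₂.hasDerivAt_slope hp ht (h₂.pos hp hδ hq hl ht))).continuousAt.continuousWithinAt

/-- Both energies vanish at `-∞`. The slope inequality makes `w₂ / w₁` increasing, so the weight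
stays bounded there. -/
lemma tendsto_compare_atBot (h₁ : EmdenFowler p δ μ q lam T w₁ P₁)
    (h₂ : EmdenFowler p δ μ q lam T w₂ P₂) (hp : 1 < p) (hδ : 0 < δ) (hq : p < q) (hl : 0 < lam)
    {t₀ : ℝ} (ht₀ : t₀ < T) (hY : ∀ t < t₀, efSlope p w₂ P₂ t < efSlope p w₁ P₁ t) :
    Tendsto (efCompare p δ μ q lam w₁ P₁ w₂ P₂) atBot (𝓝 0) := by
  have hmono : MonotoneOn (fun t => w₂ t / w₁ t) (Set.Iic t₀) := by
    have hd := fun t (ht : t < T) => hasDerivAt_ratio h₁ h₂ hp ht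
      (h₁.pos hp hδ hq hl ht) (h₂.pos hp hδ hq hl ht)
    have hT : ∀ t ∈ Set.Iic t₀, t < T := fun t ht => lt_of_le_of_lt ht ht₀
    refine monotoneOn_of_hasDerivWithinAt_nonneg (convex_Iic t₀)
      (fun t ht => (hd t (hT t ht)).continuousAt.continuousWithinAt)
      (fun t ht => (hd t (hT t (interior_subset ht))).hasDerivWithinAt) ?_
    intro t ht
    have htT := hT t (interior_subset ht)
    have h1 := h₁.pos hp hδ hq hl htT
    have h2 := h₂.pos hp hδ hq hl htT
    have h4 := sub_pos.2 (oddPow_strictMono (one_lt_conj hp) (hY t (by simpa using ht)))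
    positivity
  have hbdd : Tendsto (fun t => (w₂ t / w₁ t) ^ p * efEnergy p δ μ q lam w₁ P₁ t) atBot (𝓝 0) := by
    have hz := (h₁.tendsto_energy_atBot hp hδ hq).const_mul ((w₂ t₀ / w₁ t₀) ^ p)
    rw [mul_zero] at hz
    refine tendsto_of_tendsto_of_tendsto_of_le_of_le' tendsto_const_nhds hz ?_ ?_
    · filter_upwards [eventually_le_atBot t₀] with t ht
      have htT := ht.trans_lt ht₀
      have h1 := h₁.pos hp hδ hq hl htT
      have h2 := h₂.pos hp hδ hq hl htT
      have h3 := h₁.energy_pos hp hδ hq hl htT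
      positivity
    · filter_upwards [eventually_le_atBot t₀] with t ht
      have htT := ht.trans_lt ht₀
      have h1 := h₁.pos hp hδ hq hl htT
      have h2 := h₂.pos hp hδ hq hl htT
      have h3 := h₁.energy_pos hp hδ hq hl htT
      have h4 : w₂ t / w₁ t ≤ w₂ t₀ / w₁ t₀ := hmono ht (Set.mem_Iic.2 le_rfl) ht
      gcongr
  have := (h₂.tendsto_energy_atBot hp hδ hq).sub hbdd
  rw [sub_zero] at this
  exact this

/-- By l'Hôpital `w₂ / w₁` tends to the quotient of the limits of `w'`, whose `p`-th power has
absolute value `|L₂|^p' / |L₁|^p'`. This is exactly the ratio of the limiting energies. -/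
lemma tendsto_compare_nhdsLT (h₁ : EmdenFowler p δ μ q lam T w₁ P₁)
    (h₂ : EmdenFowler p δ μ q lam T w₂ P₂) (hp : 1 < p) (hδ : 0 < δ) (hq : p < q) (hl : 0 < lam) :
    Tendsto (efCompare p δ μ q lam w₁ P₁ w₂ P₂) (𝓝[<] T) (𝓝 0) := by
  obtain ⟨L₁, hL₁⟩ := h₁.exists_tendsto
  obtain ⟨L₂, hL₂⟩ := h₂.exists_tendsto
  have hE₁ := h₁.tendsto_energy hp hq hL₁
  have hE₂ := h₂.tendsto_energy hp hq hL₂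
  have hp' := one_lt_conj hp
  have hb : ∀ᶠ t in 𝓝[<] T, t < T := eventually_mem_nhdsWithin
  -- A vanishing limit of `P₁` would send the energy to `0` at `T`, but it is positive and
  -- increasing.
  have hL₁0 : L₁ ≠ 0 := by
    rintro rfl
    rw [abs_zero, Real.zero_rpow (by linarith), zero_div] at hE₁
    have h1 : efEnergy p δ μ q lam w₁ P₁ (T - 1) ≤ 0 := ge_of_tendsto hE₁ (by
      filter_upwards [Ioo_mem_nhdsLT (show T - 1 < T by linarith)] with t ht
      exact (h₁.energy_lt_of_pos hp hq hl ht.1 ht.2).le)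
    linarith [h₁.energy_pos hp hδ hq hl (show T - 1 < T by linarith)]
  have hl₁ : Tendsto (fun t => δ * w₁ t + oddPow (p / (p - 1)) (P₁ t)) (𝓝[<] T)
      (𝓝 (oddPow (p / (p - 1)) L₁)) := by
    simpa using (h₁.tendsto_zero.const_mul δ).add (((continuous_oddPow hp').tendsto L₁).comp hL₁)
  have hl₂ : Tendsto (fun t => δ * w₂ t + oddPow (p / (p - 1)) (P₂ t)) (𝓝[<] T)
      (𝓝 (oddPow (p / (p - 1)) L₂)) := by
    simpa using (h₂.tendsto_zero.const_mul δ).add (((continuous_oddPow hp').tendsto L₂).comp hL₂)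
  have hO₁ : oddPow (p / (p - 1)) L₁ ≠ 0 := fun h0 =>
    hL₁0 ((oddPow_strictMono hp').injective (h0.trans (oddPow_zero _).symm))
  have hr : Tendsto (fun t => w₂ t / w₁ t) (𝓝[<] T)
      (𝓝 (oddPow (p / (p - 1)) L₂ / oddPow (p / (p - 1)) L₁)) :=
    HasDerivAt.lhopital_zero_nhdsLT
      (hb.mono fun t ht => h₂.hasDerivAt_fst t ht) (hb.mono fun t ht => h₁.hasDerivAt_fst t ht)
      (hl₁.eventually_ne hO₁) h₂.tendsto_zero h₁.tendsto_zero (hl₂.div hl₁ hO₁)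
  have hr' : Tendsto (fun t => (w₂ t / w₁ t) ^ p) (𝓝[<] T)
      (𝓝 (|L₂| ^ (p / (p - 1)) / |L₁| ^ (p / (p - 1)))) := by
    have h1 := hr.abs.rpow_const (p := p) (Or.inr (by linarith))
    have e : |oddPow (p / (p - 1)) L₂ / oddPow (p / (p - 1)) L₁| ^ p =
        |L₂| ^ (p / (p - 1)) / |L₁| ^ (p / (p - 1)) := by
      rw [abs_div, abs_oddPow hp', abs_oddPow hp', Real.div_rpow (by positivity) (by positivity),
        ← Real.rpow_mul (abs_nonneg _), ← Real.rpow_mul (abs_nonneg _)]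
      have : (p / (p - 1) - 1) * p = p / (p - 1) := by
        have : p - 1 ≠ 0 := by linarith
        field_simp; ring
      rw [this]
    rw [e] at h1
    refine h1.congr' ?_
    filter_upwards [hb] with t ht
    rw [abs_of_nonneg (div_nonneg (h₂.nonneg t ht) (h₁.nonneg t ht))]
  have := hE₂.sub (hr'.mul hE₁)
  have hpos : 0 < |L₁| ^ (p / (p - 1)) := Real.rpow_pos_of_pos (abs_pos.2 hL₁0) _
  have e : |L₂| ^ (p / (p - 1)) / (p / (p - 1)) - |L₂| ^ (p / (p - 1)) / |L₁| ^ (p / (p - 1)) *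
      (|L₁| ^ (p / (p - 1)) / (p / (p - 1))) = 0 := by
    field_simp
    simp
  rw [e] at this
  exact this

/-- Go left from `t₀` to the start of the interval on which the first slope is larger. The
comparison function is `≤ 0` at that point, or tends to `0` at `-∞` if there is none, and it
decreases strictly up to `t₀`. -/
lemma compare_neg (h₁ : EmdenFowler p δ μ q lam T w₁ P₁)
    (h₂ : EmdenFowler p δ μ q lam T w₂ P₂) (hp : 1 < p) (hδ : 0 < δ) (hq : p < q) (hl : 0 < lam)
    {t₀ : ℝ} (ht₀ : t₀ < T) (hY : efSlope p w₂ P₂ t₀ < efSlope p w₁ P₁ t₀) :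
    efCompare p δ μ q lam w₁ P₁ w₂ P₂ t₀ < 0 := by
  by_cases hall : ∀ t < t₀, efSlope p w₂ P₂ t < efSlope p w₁ P₁ t
  · have hanti := strictAntiOn_compare h₁ h₂ hp hδ hq hl (convex_Iic t₀)
      (fun t ht => lt_of_le_of_lt ht ht₀) (fun t ht => hall t (by simpa using ht))
    have hlim := tendsto_compare_atBot h₁ h₂ hp hδ hq hl ht₀ hall
    have h1 : efCompare p δ μ q lam w₁ P₁ w₂ P₂ (t₀ - 1) ≤ 0 := ge_of_tendsto hlim (by
      filter_upwards [eventually_le_atBot (t₀ - 1)] with t ht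
      exact hanti.antitoneOn (Set.mem_Iic.2 (by linarith)) (Set.mem_Iic.2 (by linarith)) ht)
    have h2 := hanti (Set.mem_Iic.2 (by linarith : t₀ - 1 ≤ t₀)) (Set.mem_Iic.2 le_rfl)
      (by linarith)
    linarith
  · push Not at hall
    obtain ⟨t₁, ht₁, hle⟩ := hall
    set f := fun t => efSlope p w₁ P₁ t - efSlope p w₂ P₂ t with hf
    have hcont : ContinuousOn f (Set.Icc t₁ t₀) :=
      (continuousOn_slope_sub h₁ h₂ hp hδ hq hl).mono fun t ht => lt_of_le_of_lt ht.2 ht₀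
    set S := Set.Icc t₁ t₀ ∩ f ⁻¹' Set.Iic 0
    have hS : IsCompact S := isCompact_Icc.of_isClosed_subset
      (hcont.preimage_isClosed_of_isClosed isClosed_Icc isClosed_Iic) Set.inter_subset_left
    obtain ⟨a, ha, hmax⟩ := hS.exists_isGreatest
      ⟨t₁, ⟨le_rfl, ht₁.le⟩, by simpa [hf] using hle⟩
    have hfa : f a ≤ 0 := ha.2
    have hat : a < t₀ := lt_of_le_of_ne ha.1.2 (by rintro rfl; simp only [hf] at hfa; linarith)
    have haT := hat.trans ht₀
    have hgt : ∀ t ∈ Set.Ioc a t₀, 0 < f t := by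
      intro t ht
      by_contra! hc
      exact absurd (hmax ⟨⟨ha.1.1.trans ht.1.le, ht.2⟩, hc⟩) (not_le.2 ht.1)
    have hfa0 : f a = 0 := by
      refine le_antisymm hfa (ge_of_tendsto (x := 𝓝[>] a) (f := f) ?_ ?_)
      · exact ((continuousOn_slope_sub h₁ h₂ hp hδ hq hl).continuousAt
          (Iio_mem_nhds haT)).tendsto.mono_left nhdsWithin_le_nhds
      · filter_upwards [Ioc_mem_nhdsGT hat] with t ht using (hgt t ht).le
    have h1 := h₁.pos hp hδ hq hl haT
    have h2 := h₂.pos hp hδ hq hl haT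
    have hYa : efSlope p w₁ P₁ a = efSlope p w₂ P₂ a := sub_eq_zero.1 hfa0
    have hder := (hasDerivAt_slope_sub h₁ h₂ hp haT h1 h2 hYa).hasDerivWithinAt (s := Set.Ioi a)
    have hsl := hasDerivWithinAt_iff_tendsto_slope' (by simp) |>.1 hder
    -- The slope difference vanishes at `a` and is positive to the right, so its derivative is
    -- nonnegative; by the Riccati equation `w₁ a ≥ w₂ a` in terms of `(q-p)`-th powers.
    have hge : 0 ≤ w₁ a ^ (q - p) - w₂ a ^ (q - p) := ge_of_tendsto hsl (by
      filter_upwards [Ioc_mem_nhdsGT hat] with t ht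
      rw [slope_def_field]
      have e1 := hgt t ht
      simp only [hf] at e1 hfa0
      rw [hfa0, sub_zero]
      exact div_nonneg e1.le (by linarith [ht.1]))
    have hca : efCompare p δ μ q lam w₁ P₁ w₂ P₂ a ≤ 0 := by
      rw [compare_eq hp h1 h2 hYa]
      have : 0 < w₂ a ^ p := by positivity
      refine div_nonpos_of_nonpos_of_nonneg ?_ (by linarith)
      nlinarith
    have hanti := strictAntiOn_compare h₁ h₂ hp hδ hq hl (convex_Icc a t₀)
      (fun t ht => lt_of_le_of_lt ht.2 ht₀)
      (fun t ht => sub_pos.1 (hgt t (Set.Ioo_subset_Ioc_self (by simpa using ht))))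
    have := hanti ⟨le_rfl, hat.le⟩ ⟨hat.le, le_rfl⟩ hat
    linarith

/-- The mirror image: go right from `t₀` to the end of the interval on which the first slope is
larger, where the comparison function is `≥ 0`, or to `T`, where it tends to `0`. -/
lemma compare_pos (h₁ : EmdenFowler p δ μ q lam T w₁ P₁)
    (h₂ : EmdenFowler p δ μ q lam T w₂ P₂) (hp : 1 < p) (hδ : 0 < δ) (hq : p < q) (hl : 0 < lam)
    {t₀ : ℝ} (ht₀ : t₀ < T) (hY : efSlope p w₂ P₂ t₀ < efSlope p w₁ P₁ t₀) :
    0 < efCompare p δ μ q lam w₁ P₁ w₂ P₂ t₀ := by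
  by_cases hall : ∀ t, t₀ < t → t < T → efSlope p w₂ P₂ t < efSlope p w₁ P₁ t
  · have hanti := strictAntiOn_compare h₁ h₂ hp hδ hq hl (convex_Ico t₀ T)
      (fun t ht => ht.2) (fun t ht => by rw [interior_Ico] at ht; exact hall t ht.1 ht.2)
    have hlim := tendsto_compare_nhdsLT h₁ h₂ hp hδ hq hl
    obtain ⟨t₁, ht₁, ht₁T⟩ := exists_between ht₀
    have h1 : 0 ≤ efCompare p δ μ q lam w₁ P₁ w₂ P₂ t₁ := le_of_tendsto hlim (by
      filter_upwards [Ioo_mem_nhdsLT ht₁T] with t ht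
      exact hanti.antitoneOn ⟨ht₁.le, ht₁T⟩ ⟨(ht₁.trans ht.1).le, ht.2⟩ ht.1.le)
    have h2 := hanti ⟨le_rfl, ht₀⟩ ⟨ht₁.le, ht₁T⟩ ht₁
    linarith
  · push Not at hall
    obtain ⟨t₁, ht₁, ht₁T, hle⟩ := hall
    set f := fun t => efSlope p w₁ P₁ t - efSlope p w₂ P₂ t with hf
    have hcont : ContinuousOn f (Set.Icc t₀ t₁) :=
      (continuousOn_slope_sub h₁ h₂ hp hδ hq hl).mono fun t ht => lt_of_le_of_lt ht.2 ht₁T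
    set S := Set.Icc t₀ t₁ ∩ f ⁻¹' Set.Iic 0
    have hS : IsCompact S := isCompact_Icc.of_isClosed_subset
      (hcont.preimage_isClosed_of_isClosed isClosed_Icc isClosed_Iic) Set.inter_subset_left
    obtain ⟨b, hb, hmin⟩ := hS.exists_isLeast
      ⟨t₁, ⟨ht₁.le, le_rfl⟩, by simpa [hf] using hle⟩
    have hfb : f b ≤ 0 := hb.2
    have htb : t₀ < b := lt_of_le_of_ne hb.1.1 (by rintro rfl; simp only [hf] at hfb; linarith)
    have hbT := hb.1.2.trans_lt ht₁T
    have hgt : ∀ t ∈ Set.Ico t₀ b, 0 < f t := by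
      intro t ht
      by_contra! hc
      exact absurd (hmin ⟨⟨ht.1, ht.2.le.trans hb.1.2⟩, hc⟩) (not_le.2 ht.2)
    have hfb0 : f b = 0 := by
      refine le_antisymm hfb (ge_of_tendsto (x := 𝓝[<] b) (f := f) ?_ ?_)
      · exact ((continuousOn_slope_sub h₁ h₂ hp hδ hq hl).continuousAt
          (Iio_mem_nhds hbT)).tendsto.mono_left nhdsWithin_le_nhds
      · filter_upwards [Ico_mem_nhdsLT htb] with t ht using (hgt t ht).le
    have h1 := h₁.pos hp hδ hq hl hbT
    have h2 := h₂.pos hp hδ hq hl hbT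
    have hYb : efSlope p w₁ P₁ b = efSlope p w₂ P₂ b := sub_eq_zero.1 hfb0
    have hder := (hasDerivAt_slope_sub h₁ h₂ hp hbT h1 h2 hYb).hasDerivWithinAt (s := Set.Iio b)
    have hsl := hasDerivWithinAt_iff_tendsto_slope' (by simp) |>.1 hder
    have hge : w₁ b ^ (q - p) - w₂ b ^ (q - p) ≤ 0 := le_of_tendsto hsl (by
      filter_upwards [Ico_mem_nhdsLT htb] with t ht
      rw [slope_def_field]
      have e1 := hgt t ht
      simp only [hf] at e1 hfb0
      rw [hfb0, sub_zero]
      exact div_nonpos_of_nonneg_of_nonpos e1.le (by linarith [ht.2]))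
    have hcb : 0 ≤ efCompare p δ μ q lam w₁ P₁ w₂ P₂ b := by
      rw [compare_eq hp h1 h2 hYb]
      have : 0 < w₂ b ^ p := by positivity
      refine div_nonneg ?_ (by linarith)
      nlinarith
    have hanti := strictAntiOn_compare h₁ h₂ hp hδ hq hl (convex_Icc t₀ b)
      (fun t ht => lt_of_le_of_lt ht.2 hbT)
      (fun t ht => sub_pos.1 (hgt t (Set.Ioo_subset_Ico_self (by simpa using ht))))
    have := hanti ⟨le_rfl, htb.le⟩ ⟨htb.le, le_rfl⟩ htb
    linarith

/-- Two solutions of the Emden–Fowler system with `0 < lam` coincide. -/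
theorem eq_of_lam_pos (h₁ : EmdenFowler p δ μ q lam T w₁ P₁)
    (h₂ : EmdenFowler p δ μ q lam T w₂ P₂) (hp : 1 < p) (hδ : 0 < δ) (hq : p < q) (hl : 0 < lam)
    {t : ℝ} (ht : t < T) : w₁ t = w₂ t := by
  have hY : ∀ s < T, efSlope p w₁ P₁ s = efSlope p w₂ P₂ s := by
    intro s hs
    rcases lt_trichotomy (efSlope p w₁ P₁ s) (efSlope p w₂ P₂ s) with hlt | heq | hgt
    · have := compare_neg h₂ h₁ hp hδ hq hl hs hlt
      have := compare_pos h₂ h₁ hp hδ hq hl hs hlt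
      linarith
    · exact heq
    · have := compare_neg h₁ h₂ hp hδ hq hl hs hgt
      have := compare_pos h₁ h₂ hp hδ hq hl hs hgt
      linarith
  have h1 := h₁.pos hp hδ hq hl ht
  have h2 := h₂.pos hp hδ hq hl ht
  -- The slope difference is identically zero, so its derivative `w₁^(q-p) - w₂^(q-p)` vanishes too.
  have hd := hasDerivAt_slope_sub h₁ h₂ hp ht h1 h2 (hY t ht)
  have hd0 : HasDerivAt (fun t => efSlope p w₁ P₁ t - efSlope p w₂ P₂ t) 0 t :=
    (hasDerivAt_const t (0 : ℝ)).congr_of_eventuallyEq (by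
      filter_upwards [Iio_mem_nhds ht] with s hs
      rw [hY s hs, sub_self])
  have := hd.unique hd0
  exact Real.rpow_left_injOn (by linarith : q - p ≠ 0) h1.le h2.le (by linarith)

theorem not_of_lam_nonpos {w P : ℝ → ℝ} (h : EmdenFowler p δ μ q lam T w P) (hp : 1 < p)
    (hδ : 0 < δ) (hq : p < q) (hl : lam ≤ 0) : False := by
  rcases hl.lt_or_eq with hl | rfl
  · exact h.not_of_lam_neg hp hδ hq hl
  · exact h.not_of_lam_zero hp hδ hq

end EmdenFowler

/-! ### Polar coordinates and null sets -/

section Polar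

variable {E : Type*} [NormedAddCommGroup E] [NormedSpace ℝ E] [FiniteDimensional ℝ E]
  [MeasurableSpace E] [BorelSpace E] [Nontrivial E] (μ : Measure E) [μ.IsAddHaarMeasure]

/-- Integration in polar coordinates. -/
lemma lintegral_eq_lintegral_toSphere {F : E → ENNReal} (hF : Measurable F) :
    ∫⁻ x, F x ∂μ = ∫⁻ θ, (∫⁻ r in Set.Ioi (0 : ℝ),
      ENNReal.ofReal (r ^ (Module.finrank ℝ E - 1)) * F (r • θ.1)) ∂μ.toSphere := by
  have hm := μ.measurePreserving_homeomorphUnitSphereProd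
  have hsm : Measurable fun z : Metric.sphere (0 : E) 1 × Set.Ioi (0 : ℝ) =>
      F ((z.2 : ℝ) • (z.1 : E)) := hF.comp (by fun_prop)
  calc ∫⁻ x, F x ∂μ = ∫⁻ x in ({0}ᶜ : Set E), F x ∂μ := by rw [restrict_compl_singleton]
    _ = ∫⁻ x : ({0}ᶜ : Set E), F x ∂(μ.comap (↑)) :=
        (lintegral_subtype_comap (measurableSet_singleton _).compl _).symm
    _ = ∫⁻ z, F ((z.2 : ℝ) • (z.1 : E))
          ∂(μ.toSphere.prod (Measure.volumeIoiPow (Module.finrank ℝ E - 1))) := by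
        rw [← hm.lintegral_comp hsm]
        refine lintegral_congr fun x => ?_
        have hx : (x : E) ≠ 0 := x.2
        simp [smul_smul, hx]
    _ = ∫⁻ θ, (∫⁻ r, F (r.1 • θ.1)
          ∂(Measure.volumeIoiPow (Module.finrank ℝ E - 1))) ∂μ.toSphere :=
        lintegral_prod _ hsm.aemeasurable
    _ = _ := by
        refine lintegral_congr fun θ => ?_
        have hFr : Measurable fun r : Set.Ioi (0 : ℝ) => F (r.1 • θ.1) := hF.comp (by fun_prop)
        rw [Measure.volumeIoiPow, lintegral_withDensity_eq_lintegral_mul _ (by fun_prop) hFr, ← lintegral_subtype_comap measurableSet_Ioi]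
        rfl

/-- Tonelli applied to the indicator of a measurable null set containing the exceptional set; the
density `r^(d-1)` is positive, so it can be dropped on each ray. -/
lemma ae_toSphere_of_ae {Q : E → Prop} (hQ : ∀ᵐ x ∂μ, Q x) :
    ∀ᵐ θ ∂μ.toSphere, ∀ᵐ r ∂(volume.restrict (Set.Ioi (0 : ℝ))), Q (r • θ.1) := by
  set A := toMeasurable μ {x | ¬ Q x}
  have hA : MeasurableSet A := measurableSet_toMeasurable _ _
  have hA0 : μ A = 0 := by rw [measure_toMeasurable]; exact hQ
  have hF : Measurable (A.indicator (1 : E → ENNReal)) := measurable_one.indicator hA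
  have hF2 : Measurable fun z : Metric.sphere (0 : E) 1 × ℝ =>
      ENNReal.ofReal (z.2 ^ (Module.finrank ℝ E - 1)) *
        A.indicator (1 : E → ENNReal) (z.2 • (z.1 : E)) :=
    Measurable.mul (by fun_prop) (hF.comp (by fun_prop))
  have h := lintegral_eq_lintegral_toSphere μ hF
  rw [lintegral_indicator_one hA, hA0, eq_comm, lintegral_eq_zero_iff hF2.lintegral_prod_right'] at h
  filter_upwards [h] with θ hθ
  have hθ' := (lintegral_eq_zero_iff (hF2.comp measurable_prodMk_left)).1 hθ
  filter_upwards [hθ', ae_restrict_mem measurableSet_Ioi] with r hr hr0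
  by_contra hc
  have hmem : r • (θ : E) ∈ A := subset_toMeasurable _ _ hc
  have hr0' : (0 : ℝ) < r := hr0
  simp only [Function.comp_apply, Set.indicator_of_mem hmem, Pi.one_apply, mul_one, Pi.zero_apply,
    ENNReal.ofReal_eq_zero] at hr
  exact absurd hr (not_le.2 (by positivity))

lemma ae_norm_of_ae {Q : ℝ → Prop} (hQ : ∀ᵐ r ∂(volume.restrict (Set.Ioi (0 : ℝ))), Q r) :
    ∀ᵐ x ∂μ, Q ‖x‖ := by
  set A := toMeasurable (volume.restrict (Set.Ioi (0 : ℝ))) {x | ¬ Q x}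
  have hA : MeasurableSet A := measurableSet_toMeasurable _ _
  have hA0 : volume.restrict (Set.Ioi (0 : ℝ)) A = 0 := by rw [measure_toMeasurable]; exact hQ
  have hA' : MeasurableSet ((fun x : E => ‖x‖) ⁻¹' A) := measurable_norm hA
  have h := lintegral_eq_lintegral_toSphere μ (measurable_one.indicator hA' (f := (1 : E → ENNReal)))
  rw [lintegral_indicator_one hA'] at h
  have h0 : μ ((fun x : E => ‖x‖) ⁻¹' A) = 0 := by
    rw [h, lintegral_eq_zero_iff']
    · refine ae_of_all _ fun θ => ?_
      refine (lintegral_eq_zero_iff' ?_).2 ?_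
      · refine AEMeasurable.mul (by fun_prop) ?_
        exact ((measurable_one.indicator hA').comp (by fun_prop)).aemeasurable
      · have : ∀ᵐ r ∂(volume.restrict (Set.Ioi (0 : ℝ))), r ∉ A := measure_eq_zero_iff_ae_notMem.1 hA0
        filter_upwards [this, ae_restrict_mem measurableSet_Ioi] with r hr hr0
        have hr0' : (0 : ℝ) < r := hr0
        simp [norm_smul, abs_of_pos hr0', hr]
    · have : Measurable fun z : Metric.sphere (0 : E) 1 × ℝ =>
        ENNReal.ofReal (z.2 ^ (Module.finrank ℝ E - 1)) *
        ((fun x : E => ‖x‖) ⁻¹' A).indicator (1 : E → ENNReal) (z.2 • (z.1 : E)) :=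
        Measurable.mul (by fun_prop) ((measurable_one.indicator hA').comp (by fun_prop))
      exact (this.lintegral_prod_right').aemeasurable
  refine measure_mono_null (fun x hx => ?_) h0
  exact subset_toMeasurable _ _ hx

end Polar

/-! ### Radial Sobolev functions along a ray -/

/-- If `v` and `g` are approximated in `L¹(a, R)` by `C¹` functions vanishing at `R` and their
derivatives, then `v` is the primitive of `g` that vanishes at `R`. -/
lemma ae_eq_neg_integral_of_approx {a R : ℝ} {v g : ℝ → ℝ}
    (hv : AEMeasurable v (volume.restrict (Set.Ioo a R))) (hg : IntegrableOn g (Set.Ioo a R))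
    (h : ∀ ε : ENNReal, 0 < ε → ∃ ψ : ℝ → ℝ, ContDiff ℝ 1 ψ ∧ ψ R = 0 ∧
      ∫⁻ r in Set.Ioo a R, ‖ψ r - v r‖ₑ ≤ ε ∧ ∫⁻ r in Set.Ioo a R, ‖deriv ψ r - g r‖ₑ ≤ ε) :
    ∀ᵐ r ∂(volume.restrict (Set.Ioo a R)), v r = -∫ t in r..R, g t := by
  have hgi : ∀ r ∈ Set.Ioo a R, IntervalIntegrable g volume r R := fun r hr => by
    rw [intervalIntegrable_iff_integrableOn_Ioo_of_le hr.2.le]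
    exact hg.mono_set (Set.Ioo_subset_Ioo_left hr.1.le)
  have hmeas : AEMeasurable (fun r => ‖v r + ∫ t in r..R, g t‖ₑ)
      (volume.restrict (Set.Ioo a R)) := by
    refine (hv.add (ContinuousOn.aemeasurable ?_ measurableSet_Ioo)).enorm
    have hc : ContinuousOn (fun r => ∫ t in R..r, g t) (Set.Icc a R) := by
      rcases le_or_gt a R with haR | haR
      · have := intervalIntegral.continuousOn_primitive_interval' (f := g) (a := R) (b₁ := a)
          (b₂ := R) (μ := volume)
          ((intervalIntegrable_iff_integrableOn_Ioo_of_le haR).2 hg) Set.right_mem_uIcc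
        rwa [Set.uIcc_of_le haR] at this
      · rw [Set.Icc_eq_empty (not_le.2 haR)]; exact continuousOn_empty _
    refine (hc.neg.mono Set.Ioo_subset_Icc_self).congr fun r _ => ?_
    exact intervalIntegral.integral_symm _ _
  suffices hz : ∫⁻ r in Set.Ioo a R, ‖v r + ∫ t in r..R, g t‖ₑ = 0 by
    filter_upwards [(lintegral_eq_zero_iff' hmeas).1 hz] with r hr
    have : v r + ∫ t in r..R, g t = 0 := by simpa using hr
    linarith
  have key : ∀ ε : ENNReal, 0 < ε →
      ∫⁻ r in Set.Ioo a R, ‖v r + ∫ t in r..R, g t‖ₑ ≤ ε * (1 + volume (Set.Ioo a R)) := by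
    intro ε hε
    obtain ⟨ψ, hψ, hψR, h1, h2⟩ := h ε hε
    have hψ' : Continuous (deriv ψ) := hψ.continuous_deriv le_rfl
    have hb : ∀ r ∈ Set.Ioo a R, ‖v r + ∫ t in r..R, g t‖ₑ ≤ ‖ψ r - v r‖ₑ + ε := by
      intro r hr
      have hftc : ∫ t in r..R, deriv ψ t = ψ R - ψ r :=
        intervalIntegral.integral_deriv_eq_sub
          (fun t _ => (hψ.differentiable one_ne_zero).differentiableAt) (hψ'.intervalIntegrable _ _)
      -- Since `ψ R = 0`, the defect of `v` splits into the two approximation errors, each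
      -- controlled in `L¹`.
      have e : v r + ∫ t in r..R, g t = -(ψ r - v r) + -∫ t in r..R, (deriv ψ t - g t) := by
        rw [intervalIntegral.integral_sub (hψ'.intervalIntegrable _ _) (hgi r hr), hftc, hψR]
        ring
      rw [e]
      refine (enorm_add_le _ _).trans ?_
      rw [enorm_neg, enorm_neg]
      gcongr
      rw [intervalIntegral.integral_of_le hr.2.le]
      refine (enorm_integral_le_lintegral_enorm _).trans (le_trans ?_ h2)
      rw [← restrict_Ioo_eq_restrict_Ioc]
      exact lintegral_mono_set (Set.Ioo_subset_Ioo_left hr.1.le)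
    calc ∫⁻ r in Set.Ioo a R, ‖v r + ∫ t in r..R, g t‖ₑ
        ≤ ∫⁻ r in Set.Ioo a R, (‖ψ r - v r‖ₑ + ε) := setLIntegral_mono' measurableSet_Ioo hb
      _ = (∫⁻ r in Set.Ioo a R, ‖ψ r - v r‖ₑ) + ε * volume (Set.Ioo a R) := by
          rw [lintegral_add_right _ measurable_const, setLIntegral_const]
      _ ≤ ε + ε * volume (Set.Ioo a R) := by gcongr
      _ = _ := by ring
  have hfin : (1 + volume (Set.Ioo a R)) ≠ ⊤ := by simp
  by_contra hne
  set X := ∫⁻ r in Set.Ioo a R, ‖v r + ∫ t in r..R, g t‖ₑ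
  set K := 1 + volume (Set.Ioo a R)
  have hXfin : X ≠ ⊤ := ne_top_of_le_ne_top (by simp [K]) (key 1 one_pos)
  have hK0 : K ≠ 0 := by simp [K]
  have hpos : 0 < X / (2 * K) := ENNReal.div_pos hne (ENNReal.mul_ne_top (by simp) hfin)
  have := key _ hpos
  have e : X / (2 * K) * K = X / 2 := by
    rw [ENNReal.div_eq_inv_mul, ENNReal.mul_inv (by simp) (by simp), ENNReal.div_eq_inv_mul]
    calc 2⁻¹ * K⁻¹ * X * K = 2⁻¹ * X * (K⁻¹ * K) := by ring
      _ = _ := by rw [ENNReal.inv_mul_cancel hK0 hfin, mul_one]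
  rw [e] at this
  exact absurd this (not_le.2 (ENNReal.half_lt_self hne hXfin))

lemma continuous_gradient {N : ℕ} {φ : EuclideanSpace ℝ (Fin N) → ℝ} (hφ : ContDiff ℝ 1 φ) :
    Continuous (gradient φ) :=
  (InnerProductSpace.toDual ℝ _).symm.continuous.comp (hφ.continuous_fderiv one_ne_zero)

lemma IsTestFunction.contDiff_one {N : ℕ} {Ω : Set (EuclideanSpace ℝ (Fin N))}
    {φ : EuclideanSpace ℝ (Fin N) → ℝ} (hφ : IsTestFunction Ω φ) : ContDiff ℝ 1 φ :=
  hφ.1.of_le (by exact_mod_cast le_top)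

lemma tendsto_setLIntegral_of_tendsto_eLpNorm {α F : Type*} [MeasurableSpace α]
    [NormedAddCommGroup F] {μ : Measure α} [IsFiniteMeasure μ] {p : ℝ} (hp : 1 ≤ p)
    {f : ℕ → α → F} (hf : ∀ n, AEStronglyMeasurable (f n) μ)
    (h : Tendsto (fun n => eLpNorm (f n) (ENNReal.ofReal p) μ) atTop (𝓝 0)) :
    Tendsto (fun n => ∫⁻ x, ‖f n x‖ₑ ∂μ) atTop (𝓝 0) := by
  have hp' : (1 : ENNReal) ≤ ENNReal.ofReal p := by
    rw [← ENNReal.ofReal_one]; exact ENNReal.ofReal_le_ofReal hp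
  set K := μ Set.univ ^ (1 / (1 : ENNReal).toReal - 1 / (ENNReal.ofReal p).toReal)
  have hK : K ≠ ⊤ := by
    refine ENNReal.rpow_ne_top_of_nonneg ?_ (measure_ne_top _ _)
    rw [ENNReal.toReal_one, ENNReal.toReal_ofReal (by linarith), sub_nonneg]
    exact one_div_le_one_div_of_le one_pos hp
  have h2 := ENNReal.Tendsto.mul_const h (b := K) (Or.inr hK)
  rw [zero_mul] at h2
  refine tendsto_of_tendsto_of_tendsto_of_le_of_le tendsto_const_nhds h2 (fun _ => zero_le) ?_
  intro n
  simp only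
  rw [← eLpNorm_one_eq_lintegral_enorm]
  exact eLpNorm_le_eLpNorm_mul_rpow_measure_univ hp' (hf n)

/-- Away from the origin the polar weight is at least `δ^n`, so weighted bounds on a ray give
unweighted ones on `(δ, R)`. -/
lemma le_setLIntegral_Ioi_of_le {n : ℕ} {δ R : ℝ} (hδ : 0 < δ) {A F : ℝ → ENNReal}
    (hF : ∀ r ∈ Set.Ioo δ R, A r ≤ F r) :
    ENNReal.ofReal (δ ^ n) * ∫⁻ r in Set.Ioo δ R, A r ≤
      ∫⁻ r in Set.Ioi (0 : ℝ), ENNReal.ofReal (r ^ n) * F r := by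
  rw [← lintegral_const_mul' _ _ ENNReal.ofReal_ne_top]
  calc ∫⁻ r in Set.Ioo δ R, ENNReal.ofReal (δ ^ n) * A r
      ≤ ∫⁻ r in Set.Ioo δ R, ENNReal.ofReal (r ^ n) * F r := by
        refine setLIntegral_mono' measurableSet_Ioo fun r hr => ?_
        gcongr
        · exact hr.1.le
        · exact hF r hr
    _ ≤ _ := lintegral_mono_set fun r hr => hδ.trans hr.1

/-- A radial function in `W₀^{1,p}` of a ball is, as a function of `|x|`, the primitive vanishing
at `R` of a locally integrable function. -/
theorem MemW01p.exists_radial_primitive {N : ℕ} [Nontrivial (EuclideanSpace ℝ (Fin N))]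
    {p R : ℝ} (hp : 1 ≤ p) (hR : 0 < R) {u : EuclideanSpace ℝ (Fin N) → ℝ}
    {G : EuclideanSpace ℝ (Fin N) → EuclideanSpace ℝ (Fin N)}
    (h : MemW01p p (Metric.ball 0 R) u G) {f : ℝ → ℝ}
    (hf : ∀ᵐ x ∂(volume.restrict (Metric.ball (0 : EuclideanSpace ℝ (Fin N)) R)), u x = f ‖x‖) :
    ∃ g : ℝ → ℝ, (∀ ε > 0, IntegrableOn g (Set.Ioo ε R)) ∧
      ∀ᵐ x ∂(volume.restrict (Metric.ball (0 : EuclideanSpace ℝ (Fin N)) R)),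
        u x = -∫ t in ‖x‖..R, g t := by
  set B := Metric.ball (0 : EuclideanSpace ℝ (Fin N)) R with hB
  have hBm : MeasurableSet B := measurableSet_ball
  have hfinm : IsFiniteMeasure (volume.restrict B) := ⟨by
    rw [Measure.restrict_apply_univ]; exact measure_ball_lt_top⟩
  obtain ⟨φ, hφ, hφu, hφG⟩ := h.approx
  have hp' : (1 : ENNReal) ≤ ENNReal.ofReal p := by
    rw [← ENNReal.ofReal_one]; exact ENNReal.ofReal_le_ofReal hp
  have hφc : ∀ n, Continuous (φ n) := fun n => (hφ n).1.continuous
  have hgc : ∀ n, Continuous (gradient (φ n)) := fun n => continuous_gradient (hφ n).contDiff_one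
  obtain ⟨u', hu'm, hu'⟩ := h.memLp.1
  obtain ⟨G', hG'm, hG'⟩ := h.memLp_grad.1
  have l1 := tendsto_setLIntegral_of_tendsto_eLpNorm hp
    (fun n => (hφc n).aestronglyMeasurable.sub h.memLp.1) hφu
  have l2 := tendsto_setLIntegral_of_tendsto_eLpNorm hp
    (fun n => (hgc n).aestronglyMeasurable.sub h.memLp_grad.1) hφG
  set F : ℕ → EuclideanSpace ℝ (Fin N) → ENNReal := fun n =>
    B.indicator fun x => ‖φ n x - u' x‖ₑ + ‖gradient (φ n) x - G' x‖ₑ with hF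
  have hFm : ∀ n, Measurable (F n) := fun n =>
    (((hφc n).measurable.sub hu'm.measurable).enorm.add
      ((hgc n).measurable.sub hG'm.measurable).enorm).indicator hBm
  have hFlim : Tendsto (fun n => ∫⁻ x, F n x) atTop (𝓝 0) := by
    have e : ∀ n, ∫⁻ x, F n x = (∫⁻ x in B, ‖φ n x - u x‖ₑ) +
        ∫⁻ x in B, ‖gradient (φ n) x - G x‖ₑ := by
      intro n
      have hm : Measurable fun x => ‖φ n x - u' x‖ₑ :=
        ((hφc n).measurable.sub hu'm.measurable).enorm
      rw [hF, lintegral_indicator hBm, lintegral_add_left hm]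
      congr 1
      · exact lintegral_congr_ae (by filter_upwards [hu'] with x hx; rw [hx])
      · exact lintegral_congr_ae (by filter_upwards [hG'] with x hx; rw [hx])
    simp_rw [e]
    simpa using l1.add l2
  set d := Module.finrank ℝ (EuclideanSpace ℝ (Fin N)) - 1
  set σ := (volume : Measure (EuclideanSpace ℝ (Fin N))).toSphere
  have hprod : ∀ {H : EuclideanSpace ℝ (Fin N) → ENNReal}, Measurable H →
      Measurable fun θ : Metric.sphere (0 : EuclideanSpace ℝ (Fin N)) 1 =>
        ∫⁻ r in Set.Ioi (0 : ℝ), ENNReal.ofReal (r ^ d) * H (r • θ.1) := by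
    intro H hH
    have : Measurable fun z : Metric.sphere (0 : EuclideanSpace ℝ (Fin N)) 1 × ℝ =>
        ENNReal.ofReal (z.2 ^ d) * H (z.2 • z.1.1) :=
      Measurable.mul (by fun_prop) (hH.comp (by fun_prop))
    exact this.lintegral_prod_right'
  set I : ℕ → Metric.sphere (0 : EuclideanSpace ℝ (Fin N)) 1 → ENNReal := fun n θ =>
    ∫⁻ r in Set.Ioi (0 : ℝ), ENNReal.ofReal (r ^ d) * F n (r • θ.1) with hI
  have hIm : ∀ n, Measurable (I n) := fun n => hprod (hFm n)
  -- Fatou on the sphere: the total error tends to `0`, so for almost every direction the errors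
  -- along the ray have liminf `0`. This suffices, since only one good index is needed for each `ε`.
  have hfatou : ∀ᵐ θ ∂σ, liminf (fun n => I n θ) atTop = 0 := by
    have h1 := lintegral_liminf_le (μ := σ) (u := atTop) hIm
    have h2 : (fun n => ∫⁻ θ, I n θ ∂σ) = fun n => ∫⁻ x, F n x := by
      ext n
      exact (lintegral_eq_lintegral_toSphere volume (hFm n)).symm
    rw [h2, hFlim.liminf_eq, nonpos_iff_eq_zero, lintegral_eq_zero_iff (Measurable.liminf hIm)] at h1
    exact h1
  have hGfin : ∀ᵐ θ ∂σ, ∫⁻ r in Set.Ioi (0 : ℝ),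
      ENNReal.ofReal (r ^ d) * B.indicator (fun x => ‖G' x‖ₑ) (r • θ.1) < ⊤ := by
    have hm : Measurable (B.indicator fun x => ‖G' x‖ₑ) := hG'm.measurable.enorm.indicator hBm
    refine ae_lt_top (hprod hm) ?_
    have := lintegral_eq_lintegral_toSphere (volume : Measure (EuclideanSpace ℝ (Fin N))) hm
    rw [← this, lintegral_indicator hBm, lintegral_congr_ae (g := fun x => ‖G x‖ₑ)
      (by filter_upwards [hG'] with x hx; rw [hx])]
    exact ((h.memLp_grad.integrable hp').2).ne
  have huf : ∀ᵐ x, x ∈ B → u' x = f ‖x‖ := by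
    rw [← ae_restrict_iff' hBm]
    filter_upwards [hu', hf] with x h1 h2
    rw [← h1, h2]
  have hsl := ae_toSphere_of_ae volume huf
  have hneBot : (ae σ).NeBot := ae_neBot.2 (Measure.toSphere_ne_zero _)
  -- One direction along which the approximants converge, the gradient is integrable and `u'` agrees
  -- with the profile.
  obtain ⟨θ, hθ1, hθ2, hθ3⟩ := (hfatou.and (hGfin.and hsl)).exists
  have hθn : ‖θ.1‖ = 1 := by simp
  have hmem : ∀ r, 0 < r → r < R → r • θ.1 ∈ B := by
    intro r hr hrR
    simp [hB, norm_smul, abs_of_pos hr, hrR]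
  set g : ℝ → ℝ := fun r => inner ℝ (G' (r • θ.1)) θ.1 with hg
  have hgm : Measurable g := by
    have : Measurable fun r : ℝ => G' (r • θ.1) := hG'm.measurable.comp (by fun_prop)
    exact this.inner measurable_const
  have hgi : ∀ ε > 0, IntegrableOn g (Set.Ioo ε R) := by
    intro ε hε
    refine ⟨hgm.aestronglyMeasurable, ?_⟩
    have h1 : ENNReal.ofReal (ε ^ d) * ∫⁻ r in Set.Ioo ε R, ‖g r‖ₑ ≤
        ∫⁻ r in Set.Ioi (0 : ℝ), ENNReal.ofReal (r ^ d) *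
          B.indicator (fun x => ‖G' x‖ₑ) (r • θ.1) := by
      refine le_setLIntegral_Ioi_of_le hε fun r hr => ?_
      rw [Set.indicator_of_mem (hmem r (hε.trans hr.1) hr.2), enorm_le_iff_norm_le]
      simpa [hθn] using norm_inner_le_norm (𝕜 := ℝ) (G' (r • θ.1)) θ.1
    have h2 := h1.trans_lt hθ2
    by_contra hc
    have hc' : ∫⁻ r in Set.Ioo ε R, ‖g r‖ₑ = ⊤ := by
      simpa [HasFiniteIntegral] using hc
    rw [hc', ENNReal.mul_top (by simpa using pow_pos hε d)] at h2
    exact lt_irrefl _ h2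
  refine ⟨g, hgi, ?_⟩
  have hprim : ∀ δ > 0, ∀ᵐ r ∂(volume.restrict (Set.Ioo δ R)),
      u' (r • θ.1) = -∫ t in r..R, g t := by
    intro δ hδ
    refine ae_eq_neg_integral_of_approx ?_ (hgi δ hδ) ?_
    · exact (hu'm.measurable.comp (by fun_prop)).aemeasurable
    · intro ε hε
      have hδd : 0 < ENNReal.ofReal (δ ^ d) := by simpa using pow_pos hδ d
      have hpos : liminf (fun n => I n θ) atTop < ENNReal.ofReal (δ ^ d) * ε := by
        rw [hθ1]; exact ENNReal.mul_pos hδd.ne' hε.ne'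
      obtain ⟨n, hn⟩ := (frequently_lt_of_liminf_lt (by isBoundedDefault) hpos).exists
      have hline : ContDiff ℝ 1 fun r : ℝ => φ n (r • θ.1) :=
        (hφ n).contDiff_one.comp (by fun_prop)
      refine ⟨fun r => φ n (r • θ.1), hline, ?_, ?_, ?_⟩
      -- The boundary condition: `R • θ` lies outside the open ball, which contains the support of
      -- `φ n`.
      · apply image_eq_zero_of_notMem_tsupport
        intro hc
        have := (hφ n).2.2 hc
        simp [hB, norm_smul, abs_of_pos hR] at this
      · have : ENNReal.ofReal (δ ^ d) * ∫⁻ r in Set.Ioo δ R, ‖φ n (r • θ.1) - u' (r • θ.1)‖ₑ ≤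
            I n θ := le_setLIntegral_Ioi_of_le hδ fun r hr => by
          rw [hF]
          simp only
          rw [Set.indicator_of_mem (hmem r (hδ.trans hr.1) hr.2)]
          exact le_self_add
        exact (ENNReal.mul_le_mul_iff_right hδd.ne' ENNReal.ofReal_ne_top).1 (this.trans hn.le)
      · have hder : ∀ r, deriv (fun r : ℝ => φ n (r • θ.1)) r =
            inner ℝ (gradient (φ n) (r • θ.1)) θ.1 := by
          intro r
          rw [inner_gradient_left]
          have h1 : HasDerivAt (fun r : ℝ => r • θ.1) θ.1 r := by
            simpa using (hasDerivAt_id r).smul_const θ.1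
          exact ((((hφ n).contDiff_one.differentiable one_ne_zero) _).hasFDerivAt.comp_hasDerivAt r
            h1).deriv
        have : ENNReal.ofReal (δ ^ d) * ∫⁻ r in Set.Ioo δ R,
            ‖deriv (fun r : ℝ => φ n (r • θ.1)) r - g r‖ₑ ≤
            I n θ := le_setLIntegral_Ioi_of_le hδ fun r hr => by
          rw [hF]
          simp only
          rw [Set.indicator_of_mem (hmem r (hδ.trans hr.1) hr.2), hder, hg]
          refine le_trans ?_ le_add_self
          simp only
          rw [← inner_sub_left, enorm_le_iff_norm_le]
          simpa [hθn] using
            norm_inner_le_norm (𝕜 := ℝ) (gradient (φ n) (r • θ.1) - G' (r • θ.1)) θ.1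
        exact (ENNReal.mul_le_mul_iff_right hδd.ne' ENNReal.ofReal_ne_top).1 (this.trans hn.le)
  have hfr : ∀ᵐ r ∂(volume.restrict (Set.Ioi (0 : ℝ))), r < R → f r = -∫ t in r..R, g t := by
    -- The interval `(0, R)` is exhausted by countably many `(1/(k+1), R)`, so the exceptional set
    -- remains null.
    have hall : ∀ᵐ r, ∀ k : ℕ, r ∈ Set.Ioo (1 / ((k : ℝ) + 1)) R →
        u' (r • θ.1) = -∫ t in r..R, g t := by
      rw [ae_all_iff]
      intro k
      rw [← ae_restrict_iff' measurableSet_Ioo]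
      exact hprim _ (by positivity)
    filter_upwards [hθ3, ae_restrict_of_ae hall, ae_restrict_mem measurableSet_Ioi] with r h1 h2 h3
      hrR
    have h3' : (0 : ℝ) < r := h3
    obtain ⟨k, hk⟩ := exists_nat_one_div_lt h3'
    rw [← h2 k ⟨hk, hrR⟩, h1 (hmem r h3' hrR), norm_smul, hθn, mul_one, Real.norm_eq_abs,
      abs_of_pos h3']
  have hfx := ae_norm_of_ae (volume : Measure (EuclideanSpace ℝ (Fin N))) hfr
  filter_upwards [hf, ae_restrict_of_ae hfx, ae_restrict_mem hBm] with x h1 h2 h3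
  rw [h1, h2 (by simpa [hB] using h3)]

/-! ### The weak gradient of a radial function -/

lemma hasFDerivAt_norm_of_ne {E : Type*} [NormedAddCommGroup E] [InnerProductSpace ℝ E] {x : E} (hx : x ≠ 0) :
    HasFDerivAt (fun x : E => ‖x‖) (‖x‖⁻¹ • innerSL ℝ x) x := by
  have h := (hasStrictFDerivAt_norm_sq x).hasFDerivAt.sqrt
    (pow_ne_zero 2 (norm_ne_zero_iff.2 hx))
  have e : (fun y : E => √(‖y‖ ^ 2)) = fun y => ‖y‖ := by ext y; simp
  rw [e] at h
  convert! h using 1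
  rw [Real.sqrt_sq (norm_nonneg _)]
  ext y
  simp
  field_simp

section RadialParts

variable {E : Type*} [NormedAddCommGroup E] [InnerProductSpace ℝ E] [FiniteDimensional ℝ E]
  [MeasurableSpace E] [BorelSpace E] {μ : Measure E} [μ.IsAddHaarMeasure]

/-- The function `∫ t in ‖x‖..R, g t` is differentiable off the origin with gradient `-g(‖x‖)
x/‖x‖`, and `φ` vanishes near the origin, so classical integration by parts applies. -/
lemma integral_mul_radial_of_continuous {g : ℝ → ℝ} (hg : Continuous g) (R : ℝ) {φ : E → ℝ}
    (hφ : ContDiff ℝ 1 φ) (hc : HasCompactSupport φ) (h0 : (0 : E) ∉ tsupport φ) (v : E) :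
    ∫ x, φ x * (g ‖x‖ * (inner ℝ x v / ‖x‖)) ∂μ =
      ∫ x, (∫ t in ‖x‖..R, g t) * fderiv ℝ φ x v ∂μ := by
  have hprim : ∀ r : ℝ, HasDerivAt (fun r => ∫ t in r..R, g t) (-g r) r := fun r =>
    intervalIntegral.integral_hasDerivAt_left (hg.intervalIntegrable _ _)
      (hg.stronglyMeasurableAtFilter _ _) hg.continuousAt
  have hne : ∀ x ∈ tsupport φ, x ≠ 0 := fun x hx h => h0 (h ▸ hx)
  have hd : ∀ x : E, x ≠ 0 → HasFDerivAt (fun x : E => ∫ t in ‖x‖..R, g t)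
      (-g ‖x‖ • (‖x‖⁻¹ • innerSL ℝ x)) x := fun x hx =>
    (hprim ‖x‖).comp_hasFDerivAt x (hasFDerivAt_norm_of_ne hx)
  have hprimc : Continuous fun r : ℝ => ∫ t in r..R, g t :=
    continuous_iff_continuousAt.2 fun r => (hprim r).continuousAt
  have hFc : Continuous fun x : E => ∫ t in ‖x‖..R, g t := hprimc.comp continuous_norm
  have hφ'c : Continuous fun x => fderiv ℝ φ x v :=
    (hφ.continuous_fderiv one_ne_zero).clm_apply continuous_const
  have e : (fun x => fderiv ℝ (fun x : E => ∫ t in ‖x‖..R, g t) x v * φ x) =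
      fun x => -(φ x * (g ‖x‖ * (inner ℝ x v / ‖x‖))) := by
    ext x
    by_cases hx : x ∈ tsupport φ
    · rw [(hd x (hne x hx)).fderiv]
      simp
      ring
    · simp [image_eq_zero_of_notMem_tsupport hx]
  have hcont : Continuous fun x => φ x * (g ‖x‖ * (inner ℝ x v / ‖x‖)) := by
    refine continuous_of_tsupport fun x hx => ?_
    have hx' := hne x (closure_mono (Function.support_mul_subset_left _ _) hx)
    have h1 : ContinuousAt (fun x : E => inner ℝ x v / ‖x‖) x :=
      ContinuousAt.div (by fun_prop) (by fun_prop) (norm_ne_zero_iff.2 hx')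
    have h2 : ContinuousAt (fun x : E => g ‖x‖) x := by fun_prop
    exact hφ.continuous.continuousAt.mul (h2.mul h1)
  have hint : Integrable (fun x => φ x * (g ‖x‖ * (inner ℝ x v / ‖x‖))) μ :=
    hcont.integrable_of_hasCompactSupport hc.mul_right
  have := integral_mul_fderiv_eq_neg_fderiv_mul_of_integrable (μ := μ) (v := v)
    (f := fun x : E => ∫ t in ‖x‖..R, g t) (g := φ)
    (by rw [e]; exact hint.neg)
    ((hFc.mul hφ'c).integrable_of_hasCompactSupport (hc.fderiv_apply ℝ v).mul_left)
    ((hFc.mul hφ.continuous).integrable_of_hasCompactSupport hc.mul_left)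
    (fun x hx => (hd x (hne x hx)).differentiableAt)
    (fun x _ => (hφ.differentiable one_ne_zero) x)
  rw [this, e, integral_neg, neg_neg]

lemma integrable_radial_indicator [Nontrivial E] {k : ℝ → ℝ} (hk : Integrable k) {ε R : ℝ} :
    Integrable (fun x : E => (Set.Ioo ε R).indicator k ‖x‖) μ := by
  rw [integrable_fun_norm_addHaar]
  have h1 : IntegrableOn ((Set.Ioo ε R).indicator k) (Set.Ioi 0) :=
    (hk.indicator measurableSet_Ioo).integrableOn
  refine (Integrable.bdd_mul (c := |R| ^ (Module.finrank ℝ E - 1)) h1 (f := fun y =>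
    (Set.Ioo 0 R).indicator (fun y : ℝ => y ^ (Module.finrank ℝ E - 1)) y) ?_ ?_).congr ?_
  · exact (Measurable.indicator (by fun_prop) measurableSet_Ioo).aestronglyMeasurable
  · refine ae_of_all _ fun y => ?_
    by_cases hy : y ∈ Set.Ioo 0 R
    · rw [Set.indicator_of_mem hy, norm_pow, Real.norm_eq_abs]
      gcongr 1
      exact abs_le_abs_of_nonneg hy.1.le hy.2.le
    · rw [Set.indicator_of_notMem hy, norm_zero]; positivity
  · filter_upwards [ae_restrict_mem measurableSet_Ioi] with y hy
    have hy' : (0 : ℝ) < y := hy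
    by_cases hyR : y < R
    · simp [hyR, hy']
    · simp [hyR]

/-- Integration by parts against `∇ (∫_{|x|}^R g)` for an integrable profile `g`. -/
lemma integral_mul_radial [Nontrivial E] {g : ℝ → ℝ} (hg : Integrable g) {ε R : ℝ} (hε : 0 < ε)
    {φ : E → ℝ} (hφ : ContDiff ℝ 1 φ) (hc : HasCompactSupport φ)
    (hsupp : tsupport φ ⊆ {x | ‖x‖ ∈ Set.Ioo ε R}) (v : E) :
    ∫ x, φ x * (g ‖x‖ * (inner ℝ x v / ‖x‖)) ∂μ =
      ∫ x, (∫ t in ‖x‖..R, g t) * fderiv ℝ φ x v ∂μ := by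
  have h0 : (0 : E) ∉ tsupport φ := fun h => by
    have := (hsupp h).1
    simp at this
    linarith
  obtain ⟨M, hM⟩ := hc.exists_bound_of_continuous hφ.continuous
  have hM0 : 0 ≤ M := (norm_nonneg _).trans (hM 0)
  have hφ'c : Continuous fun x => fderiv ℝ φ x v :=
    (hφ.continuous_fderiv one_ne_zero).clm_apply continuous_const
  have hφ's : HasCompactSupport fun x => fderiv ℝ φ x v := hc.fderiv_apply ℝ v
  have hφ'i : Integrable (fun x => fderiv ℝ φ x v) μ := hφ'c.integrable_of_hasCompactSupport hφ's
  have hφ'0 : ∀ x : E, ‖x‖ ∉ Set.Ioo ε R → fderiv ℝ φ x v = 0 := by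
    intro x hx
    have : x ∉ tsupport φ := fun h => hx (hsupp h)
    have h2 : fderiv ℝ φ x = 0 := image_eq_zero_of_notMem_tsupport
      (fun h => this (tsupport_fderiv_subset ℝ h))
    simp [h2]
  have hφ0 : ∀ x : E, ‖x‖ ∉ Set.Ioo ε R → φ x = 0 := fun x hx =>
    image_eq_zero_of_notMem_tsupport fun h => hx (hsupp h)
  have hiA : ∀ k : ℝ → ℝ, Integrable k →
      Integrable (fun x => φ x * (k ‖x‖ * (inner ℝ x v / ‖x‖))) μ := by
    intro k hk
    have h1 := integrable_radial_indicator (μ := μ) (E := E) hk (ε := ε) (R := R)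
    have h2 : AEStronglyMeasurable (fun x : E => φ x * (inner ℝ x v / ‖x‖)) μ := by
      refine (hφ.continuous.measurable.mul ?_).aestronglyMeasurable
      exact Measurable.div (by fun_prop) measurable_norm
    refine (h1.bdd_mul (c := M * ‖v‖) h2 (ae_of_all _ fun x => ?_)).congr (ae_of_all _ fun x => ?_)
    · rw [norm_mul]
      refine mul_le_mul (hM x) ?_ (norm_nonneg _) hM0
      rw [norm_div, norm_norm]
      refine div_le_of_le_mul₀ (norm_nonneg _) (norm_nonneg _) ?_
      rw [mul_comm]
      exact norm_inner_le_norm _ _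
    · by_cases hx : ‖x‖ ∈ Set.Ioo ε R
      · simp only [Set.indicator_of_mem hx]; ring
      · simp [hφ0 x hx]
  have hprimc : ∀ k : ℝ → ℝ, Integrable k → Continuous fun x : E => ∫ t in ‖x‖..R, k t := by
    intro k hk
    have h1 := intervalIntegral.continuous_primitive
      (fun a b => hk.intervalIntegrable (a := a) (b := b)) R
    have h2 : Continuous fun r : ℝ => ∫ t in r..R, k t := by
      refine h1.neg.congr fun r => ?_
      exact (intervalIntegral.integral_symm _ _).symm
    exact h2.comp continuous_norm
  have hiB : ∀ k : ℝ → ℝ, Integrable k →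
      Integrable (fun x => (∫ t in ‖x‖..R, k t) * fderiv ℝ φ x v) μ := fun k hk =>
    ((hprimc k hk).mul hφ'c).integrable_of_hasCompactSupport hφ's.mul_left
  -- Both sides are bounded by a constant times the `L¹` norm of the profile: the left by polar
  -- coordinates on `(ε, R)`, the right by the sup bound on the primitive. `K` is the sum of these
  -- constants, so continuous profiles suffice by density.
  set K := M * ‖v‖ * ((Module.finrank ℝ E) • μ.real (Metric.ball 0 1) *
    |R| ^ (Module.finrank ℝ E - 1)) + ∫ x, ‖fderiv ℝ φ x v‖ ∂μ with hK
  have hK0 : 0 ≤ K := by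
    have : 0 ≤ ∫ x, ‖fderiv ℝ φ x v‖ ∂μ := integral_nonneg fun _ => norm_nonneg _
    positivity
  refine eq_of_abs_sub_le_all fun δ hδ => ?_
  obtain ⟨η, -, hηδ, hηc, hηi⟩ := hg.exists_hasCompactSupport_integral_sub_le
    (show 0 < δ / (K + 1) by positivity)
  have hgη : Integrable fun t => g t - η t := hg.sub hηi
  have eA : ∫ x, φ x * (g ‖x‖ * (inner ℝ x v / ‖x‖)) ∂μ =
      ∫ x, φ x * ((g ‖x‖ - η ‖x‖) * (inner ℝ x v / ‖x‖)) ∂μ +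
      ∫ x, φ x * (η ‖x‖ * (inner ℝ x v / ‖x‖)) ∂μ := by
    rw [← integral_add (hiA _ hgη) (hiA _ hηi)]
    exact integral_congr_ae (ae_of_all _ fun x => by simp only; ring)
  have eB : ∫ x, (∫ t in ‖x‖..R, g t) * fderiv ℝ φ x v ∂μ =
      ∫ x, (∫ t in ‖x‖..R, (g t - η t)) * fderiv ℝ φ x v ∂μ +
      ∫ x, (∫ t in ‖x‖..R, η t) * fderiv ℝ φ x v ∂μ := by
    rw [← integral_add (hiB _ hgη) (hiB _ hηi)]
    refine integral_congr_ae (ae_of_all _ fun x => ?_)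
    simp only
    rw [intervalIntegral.integral_sub hg.intervalIntegrable hηi.intervalIntegrable]
    ring
  have bA : |∫ x, φ x * ((g ‖x‖ - η ‖x‖) * (inner ℝ x v / ‖x‖)) ∂μ| ≤
      M * ‖v‖ * ((Module.finrank ℝ E) • μ.real (Metric.ball 0 1) *
        |R| ^ (Module.finrank ℝ E - 1)) * ∫ t, ‖g t - η t‖ := by
    have h1 := integrable_radial_indicator (μ := μ) (E := E) hgη.norm (ε := ε) (R := R)
    have h2 : |∫ x, φ x * ((g ‖x‖ - η ‖x‖) * (inner ℝ x v / ‖x‖)) ∂μ| ≤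
        ∫ x, M * ‖v‖ * (Set.Ioo ε R).indicator (fun t => ‖g t - η t‖) ‖x‖ ∂μ := by
      refine (abs_integral_le_integral_abs).trans ?_
      refine integral_mono_of_nonneg (ae_of_all _ fun x => abs_nonneg _) (h1.const_mul _)
        (ae_of_all _ fun x => ?_)
      by_cases hx : ‖x‖ ∈ Set.Ioo ε R
      · simp only [Set.indicator_of_mem hx]
        rw [abs_mul, abs_mul, Real.norm_eq_abs]
        have h3 : |inner ℝ x v / ‖x‖| ≤ ‖v‖ := by
          rw [abs_div, abs_norm]
          refine div_le_of_le_mul₀ (norm_nonneg _) (norm_nonneg _) ?_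
          rw [mul_comm]
          exact abs_real_inner_le_norm _ _
        calc |φ x| * (|g ‖x‖ - η ‖x‖| * |inner ℝ x v / ‖x‖|)
            ≤ M * (|g ‖x‖ - η ‖x‖| * ‖v‖) := by
              have := hM x
              rw [Real.norm_eq_abs] at this
              gcongr
          _ = _ := by ring
      · simp [hφ0 x hx, Set.indicator_of_notMem hx]
    refine h2.trans ?_
    rw [integral_const_mul, integral_fun_norm_addHaar, mul_assoc]
    rw [mul_assoc, mul_assoc]
    refine mul_le_mul_of_nonneg_left ?_ hM0
    refine mul_le_mul_of_nonneg_left ?_ (norm_nonneg _)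
    rw [← smul_assoc, smul_eq_mul, mul_assoc]
    refine mul_le_mul_of_nonneg_left ?_ (by positivity)
    rw [← integral_const_mul]
    calc ∫ y in Set.Ioi (0 : ℝ), y ^ (Module.finrank ℝ E - 1) •
          (Set.Ioo ε R).indicator (fun t => ‖g t - η t‖) y
        ≤ ∫ y in Set.Ioi (0 : ℝ), |R| ^ (Module.finrank ℝ E - 1) * ‖g y - η y‖ := by
          refine integral_mono_of_nonneg ?_ ((hgη.norm.const_mul _).integrableOn) ?_
          · filter_upwards [ae_restrict_mem measurableSet_Ioi] with y hy
            have hy' : (0 : ℝ) < y := hy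
            have : 0 ≤ (Set.Ioo ε R).indicator (fun t => ‖g t - η t‖) y :=
              Set.indicator_nonneg (fun _ _ => norm_nonneg _) _
            simp only [Pi.zero_apply, smul_eq_mul]
            positivity
          · filter_upwards [ae_restrict_mem measurableSet_Ioi] with y hy
            have hy' : (0 : ℝ) < y := hy
            by_cases hyI : y ∈ Set.Ioo ε R
            · simp only [Set.indicator_of_mem hyI, smul_eq_mul]
              have : y ≤ |R| := hyI.2.le.trans (le_abs_self R)
              gcongr
            · simp only [Set.indicator_of_notMem hyI, smul_zero]
              positivity
      _ ≤ ∫ y, |R| ^ (Module.finrank ℝ E - 1) * ‖g y - η y‖ :=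
          setIntegral_le_integral (hgη.norm.const_mul _) (ae_of_all _ fun y => by positivity)
  have bB : |∫ x, (∫ t in ‖x‖..R, (g t - η t)) * fderiv ℝ φ x v ∂μ| ≤
      (∫ x, ‖fderiv ℝ φ x v‖ ∂μ) * ∫ t, ‖g t - η t‖ := by
    refine (abs_integral_le_integral_abs).trans ?_
    rw [← integral_mul_const]
    refine integral_mono (hiB _ hgη).abs (hφ'i.norm.mul_const _) fun x => ?_
    simp only
    rw [abs_mul, mul_comm, Real.norm_eq_abs (fderiv ℝ φ x v)]
    refine mul_le_mul_of_nonneg_left ?_ (abs_nonneg _)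
    rw [← Real.norm_eq_abs]
    refine (intervalIntegral.norm_integral_le_integral_norm_uIoc).trans ?_
    exact setIntegral_le_integral hgη.norm (ae_of_all _ fun y => norm_nonneg _)
  rw [eA, eB, integral_mul_radial_of_continuous hηc R hφ hc h0 v, add_sub_add_right_eq_sub]
  refine (abs_sub _ _).trans ((add_le_add bA bB).trans ?_)
  rw [← add_mul, ← hK]
  calc K * ∫ t, ‖g t - η t‖ ≤ K * (δ / (K + 1)) := by gcongr
    _ ≤ (K + 1) * (δ / (K + 1)) := by gcongr; linarith
    _ = δ := by field_simp

end RadialParts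

lemma integrable_radial_field {E : Type*} [NormedAddCommGroup E] [InnerProductSpace ℝ E]
    [FiniteDimensional ℝ E] [MeasurableSpace E] [BorelSpace E] [Nontrivial E] {μ : Measure E}
    [μ.IsAddHaarMeasure] {g : ℝ → ℝ} {ε R : ℝ} (hg : IntegrableOn g (Set.Ioo ε R)) :
    Integrable (fun x : E => ((Set.Ioo ε R).indicator g ‖x‖ / ‖x‖) • x) μ := by
  have h1 := integrable_radial_indicator (μ := μ) (E := E)
    (hg.integrable_indicator measurableSet_Ioo) (ε := ε) (R := R)
  simp only [Set.indicator_indicator, Set.inter_self] at h1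
  refine h1.mono ?_ (ae_of_all _ fun x => ?_)
  · have h2 : Measurable fun x : E => ‖x‖⁻¹ • x := by fun_prop
    refine (h1.1.smul h2.aestronglyMeasurable).congr (ae_of_all _ fun x => ?_)
    simp [smul_smul, div_eq_mul_inv]
  · rw [norm_smul, norm_div, norm_norm, div_mul_eq_mul_div]
    exact div_le_of_le_mul₀ (norm_nonneg _) (norm_nonneg _) le_rfl

lemma gradient_eq_zero_of_notMem_tsupport {N : ℕ} {φ : EuclideanSpace ℝ (Fin N) → ℝ}
    {x : EuclideanSpace ℝ (Fin N)} (hx : x ∉ tsupport φ) : gradient φ x = 0 := by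
  have h2 : fderiv ℝ φ x = 0 := image_eq_zero_of_notMem_tsupport
    fun hc => hx (tsupport_fderiv_subset ℝ hc)
  simp [gradient, h2]

/-- The weak gradient of a radial function is radial. -/
theorem HasWeakGradient.eq_of_radial {N : ℕ} [Nontrivial (EuclideanSpace ℝ (Fin N))]
    {R : ℝ} {u : EuclideanSpace ℝ (Fin N) → ℝ}
    {G : EuclideanSpace ℝ (Fin N) → EuclideanSpace ℝ (Fin N)}
    (h : HasWeakGradient (Metric.ball 0 R) u G) (hG : IntegrableOn G (Metric.ball 0 R))
    {g : ℝ → ℝ} (hg : ∀ ε > 0, IntegrableOn g (Set.Ioo ε R))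
    (hu : ∀ᵐ x ∂(volume.restrict (Metric.ball (0 : EuclideanSpace ℝ (Fin N)) R)),
      u x = -∫ t in ‖x‖..R, g t) :
    ∀ᵐ x ∂(volume.restrict (Metric.ball (0 : EuclideanSpace ℝ (Fin N)) R)),
      G x = (g ‖x‖ / ‖x‖) • x := by
  set B := Metric.ball (0 : EuclideanSpace ℝ (Fin N)) R with hB
  have hBm : MeasurableSet B := measurableSet_ball
  set V : EuclideanSpace ℝ (Fin N) → EuclideanSpace ℝ (Fin N) := fun x => (g ‖x‖ / ‖x‖) • x with hV
  -- The origin is removed because `g` is only known to be integrable away from `0`; a point is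
  -- null, so nothing is lost.
  have hU : IsOpen (B \ {0}) := Metric.isOpen_ball.sdiff isClosed_singleton
  have hVloc : LocallyIntegrableOn V (B \ {0}) := by
    intro x hx
    have hx0 : 0 < ‖x‖ := norm_pos_iff.2 hx.2
    have hxR : ‖x‖ < R := by simpa [hB] using hx.1
    have hopen : IsOpen {y : EuclideanSpace ℝ (Fin N) | ‖y‖ ∈ Set.Ioo (‖x‖ / 2) R} :=
      isOpen_Ioo.preimage continuous_norm
    refine ⟨{y | ‖y‖ ∈ Set.Ioo (‖x‖ / 2) R},
      mem_nhdsWithin_of_mem_nhds (hopen.mem_nhds ⟨by linarith, hxR⟩), ?_⟩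
    refine (integrable_radial_field (μ := volume)
      (hg (‖x‖ / 2) (by positivity))).integrableOn.congr_fun ?_ hopen.measurableSet
    intro y hy
    have hy' : ‖y‖ ∈ Set.Ioo (‖x‖ / 2) R := hy
    simp only [hV, Set.indicator_of_mem hy']
  have key := hU.ae_eq_zero_of_integral_contDiff_smul_eq_zero (μ := volume) (f := fun x => G x - V x)
    (((hG.mono_set Set.sdiff_subset).locallyIntegrableOn).sub hVloc) ?_
  · rw [ae_restrict_iff' hBm]
    have h0 : ∀ᵐ x : EuclideanSpace ℝ (Fin N), x ≠ 0 := by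
      simp [ae_iff]
    filter_upwards [key, h0] with x hx hx0 hxB
    exact sub_eq_zero.1 (hx ⟨hxB, hx0⟩)
  intro φ hφ hφc hφs
  have hφ1 : ContDiff ℝ 1 φ := hφ.of_le (by exact_mod_cast le_top)
  have htest : IsTestFunction B φ := ⟨hφ, hφc, hφs.trans Set.sdiff_subset⟩
  obtain ⟨ε, hε, hεs⟩ : ∃ ε > 0, tsupport φ ⊆ {x | ‖x‖ ∈ Set.Ioo ε R} := by
    have h0 : (tsupport φ)ᶜ ∈ 𝓝 (0 : EuclideanSpace ℝ (Fin N)) :=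
      (isClosed_tsupport φ).isOpen_compl.mem_nhds fun hc => (hφs hc).2 rfl
    obtain ⟨ε, hε, hsub⟩ := Metric.mem_nhds_iff.1 h0
    refine ⟨ε / 2, by positivity, fun x hx => ⟨?_, by simpa [hB] using (hφs hx).1⟩⟩
    by_contra! hc
    exact hsub (show x ∈ Metric.ball 0 ε by simp; linarith) hx
  -- Truncation makes the profile globally integrable and changes nothing on the support of `φ`.
  set g₁ := (Set.Ioo ε R).indicator g with hg₁
  have hg₁i : Integrable g₁ := (hg ε hε).integrable_indicator measurableSet_Ioo
  have hφ0 : ∀ x, ‖x‖ ∉ Set.Ioo ε R → φ x = 0 := fun x hx =>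
    image_eq_zero_of_notMem_tsupport fun hc => hx (hεs hc)
  obtain ⟨M, hM⟩ := hφc.exists_bound_of_continuous hφ.continuous
  have hφB : ∀ x, x ∉ B → φ x = 0 := fun x hx =>
    image_eq_zero_of_notMem_tsupport fun hc => hx (htest.2.2 hc)
  have hiG : Integrable fun x => φ x • G x := by
    rw [← integrableOn_iff_integrable_of_support_subset (s := B)]
    · exact hG.bdd_smul M hφ.continuous.aestronglyMeasurable (ae_of_all _ hM)
    · intro x hx
      by_contra hc
      exact hx (by simp [hφB x hc])
  have hVeq : (fun x => φ x • V x) = fun x => φ x • ((g₁ ‖x‖ / ‖x‖) • x) := by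
    ext1 x
    by_cases hx : ‖x‖ ∈ Set.Ioo ε R
    · simp only [hV, hg₁, Set.indicator_of_mem hx]
    · simp [hφ0 x hx]
  have hiV : Integrable fun x => φ x • V x := by
    rw [hVeq]
    exact (integrable_radial_field (hg ε hε)).bdd_smul M
      hφ.continuous.aestronglyMeasurable (ae_of_all _ hM)
  have hiU : IntegrableOn (fun x => u x • gradient φ x) B := by
    have hgrad := continuous_gradient hφ1
    have hcs : HasCompactSupport (gradient φ) := HasCompactSupport.intro hφc fun x hx =>
      gradient_eq_zero_of_notMem_tsupport hx
    have h1 := intervalIntegral.continuous_primitive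
      (fun a b => hg₁i.intervalIntegrable (a := a) (b := b)) R
    have hc : Continuous fun x : EuclideanSpace ℝ (Fin N) =>
        (∫ t in R..‖x‖, g₁ t) • gradient φ x :=
      (h1.comp continuous_norm).smul hgrad
    have hcs' : HasCompactSupport fun x : EuclideanSpace ℝ (Fin N) =>
        (∫ t in R..‖x‖, g₁ t) • gradient φ x := HasCompactSupport.intro hφc fun x hx => by
      rw [gradient_eq_zero_of_notMem_tsupport hx, smul_zero]
    refine ((hc.integrable_of_hasCompactSupport hcs').integrableOn).congr_fun_ae ?_
    filter_upwards [hu] with x hx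
    by_cases hxI : ‖x‖ ∈ Set.Ioo ε R
    · rw [hx, ← intervalIntegral.integral_symm]
      congr 1
      rw [intervalIntegral.integral_symm, intervalIntegral.integral_symm ‖x‖]
      congr 1
      rw [intervalIntegral.integral_of_le hxI.2.le, intervalIntegral.integral_of_le hxI.2.le,
        ← restrict_Ioo_eq_restrict_Ioc]
      refine setIntegral_congr_fun measurableSet_Ioo fun t ht => ?_
      simp only [hg₁]
      rw [Set.indicator_of_mem (show t ∈ Set.Ioo ε R from ⟨hxI.1.trans ht.1, ht.2⟩)]
    · have : gradient φ x = 0 := gradient_eq_zero_of_notMem_tsupport fun hc => hxI (hεs hc)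
      simp [this]
  have hweak := h φ htest
  rw [setIntegral_eq_integral_of_forall_compl_eq_zero (f := fun x => φ x • G x)
    (fun x hx => by simp [hφB x hx])] at hweak
  have hsub : ∫ x, φ x • (G x - V x) = (∫ x, φ x • G x) - ∫ x, φ x • V x := by
    rw [← integral_sub hiG hiV]
    simp_rw [smul_sub]
  rw [hsub, sub_eq_zero]
  refine ext_inner_left ℝ fun v => ?_
  have hV2 : inner ℝ v (∫ x, φ x • V x) = ∫ x, φ x * (g₁ ‖x‖ * (inner ℝ x v / ‖x‖)) := by
    rw [← integral_inner hiV]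
    refine integral_congr_ae (ae_of_all _ fun x => ?_)
    have := congrFun hVeq x
    simp only at this ⊢
    rw [this, inner_smul_right, inner_smul_right, real_inner_comm]
    ring
  have hG2 : inner ℝ v (∫ x, φ x • G x) = -∫ x in B, u x * fderiv ℝ φ x v := by
    have : ∫ x, φ x • G x = -∫ x in B, u x • gradient φ x := by rw [hweak, neg_neg]
    rw [this, inner_neg_right, ← integral_inner hiU]
    congr 1
    refine integral_congr_ae (ae_of_all _ fun x => ?_)
    simp only
    rw [inner_smul_right, real_inner_comm, inner_gradient_left]
  rw [hV2, hG2, integral_mul_radial hg₁i hε hφ1 hφc hεs v, ← integral_neg]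
  have hd0 : ∀ x, ‖x‖ ∉ Set.Ioo ε R → fderiv ℝ φ x v = 0 := by
    intro x hx
    have h2 : fderiv ℝ φ x = 0 := image_eq_zero_of_notMem_tsupport
      (fun hc => hx (hεs (tsupport_fderiv_subset ℝ hc)))
    simp [h2]
  rw [← setIntegral_eq_integral_of_forall_compl_eq_zero (s := B)
    (f := fun x => (∫ t in ‖x‖..R, g₁ t) * fderiv ℝ φ x v)]
  · refine integral_congr_ae ?_
    filter_upwards [hu] with x hx
    by_cases hxI : ‖x‖ ∈ Set.Ioo ε R
    · rw [hx, neg_mul, neg_neg]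
      congr 1
      rw [intervalIntegral.integral_of_le hxI.2.le, intervalIntegral.integral_of_le hxI.2.le,
        ← restrict_Ioo_eq_restrict_Ioc]
      refine setIntegral_congr_fun measurableSet_Ioo fun t ht => ?_
      simp only [hg₁]
      rw [Set.indicator_of_mem (show t ∈ Set.Ioo ε R from ⟨hxI.1.trans ht.1, ht.2⟩)]
    · simp [hd0 x hxI]
  · intro x hx
    rw [hd0 x (fun hc => hx (by simpa [hB] using hc.2)), mul_zero]

/-! ### Du Bois-Reymond's lemma -/

/-- The primitive of a smooth function of zero mean supported in `(a, b)` is smooth and compactly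
supported in `(a, b)`. -/
lemma exists_primitive_of_integral_eq_zero {a b : ℝ} {ζ : ℝ → ℝ} (hζ : ContDiff ℝ ∞ ζ)
    (hc : HasCompactSupport ζ) (hs : tsupport ζ ⊆ Set.Ioo a b) (h0 : ∫ x, ζ x = 0) :
    ∃ Z : ℝ → ℝ, ContDiff ℝ ∞ Z ∧ HasCompactSupport Z ∧ tsupport Z ⊆ Set.Ioo a b ∧
      deriv Z = ζ := by
  rcases (tsupport ζ).eq_empty_or_nonempty with he | hne
  · refine ⟨0, contDiff_const, HasCompactSupport.zero, by simp [tsupport], ?_⟩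
    rw [tsupport_eq_empty_iff.1 he]
    ext x; simp
  have hinf := hs (hc.isCompact.sInf_mem hne)
  have hsup := hs (hc.isCompact.sSup_mem hne)
  set α := sInf (tsupport ζ)
  set β := sSup (tsupport ζ)
  have hsub : tsupport ζ ⊆ Set.Icc α β := fun x hx =>
    ⟨csInf_le hc.isCompact.bddBelow hx, le_csSup hc.isCompact.bddAbove hx⟩
  have hd : ∀ x, HasDerivAt (fun x => ∫ t in α..x, ζ t) (ζ x) x := fun x =>
    hζ.continuous.integral_hasStrictDerivAt α x |>.hasDerivAt
  have hderiv : deriv (fun x => ∫ t in α..x, ζ t) = ζ := funext fun x => (hd x).deriv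
  have hz : ∀ x, x ∉ Set.Icc α β → ζ x = 0 := fun x hx =>
    image_eq_zero_of_notMem_tsupport fun h => hx (hsub h)
  have hαβ : α ≤ β := (hsub (hc.isCompact.sInf_mem hne)).2
  have hsupp : tsupport (fun x => ∫ t in α..x, ζ t) ⊆ Set.Icc α β := by
    refine closure_minimal (fun x hx => ?_) isClosed_Icc
    by_contra hxI
    refine hx ?_
    rw [Set.mem_Icc, not_and_or, not_le, not_le] at hxI
    rcases hxI with hlt | hgt
    · refine intervalIntegral.integral_zero_ae ?_
      have : ∀ᵐ t : ℝ, t ≠ α := by simp [ae_iff]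
      filter_upwards [this] with t ht htI
      rw [Set.uIoc_of_ge hlt.le] at htI
      exact hz t fun h => ht (le_antisymm htI.2 h.1)
    · simp only
      rw [intervalIntegral.integral_of_le (hαβ.trans hgt.le), ← h0, ← integral_Icc_eq_integral_Ioc]
      refine setIntegral_eq_integral_of_forall_compl_eq_zero fun t ht => hz t fun h => ht ?_
      exact ⟨h.1, h.2.trans hgt.le⟩
  refine ⟨fun x => ∫ t in α..x, ζ t, ?_, ?_, ?_, hderiv⟩
  · rw [contDiff_infty_iff_deriv, hderiv]
    exact ⟨fun x => (hd x).differentiableAt, hζ⟩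
  · exact HasCompactSupport.of_support_subset_isCompact isCompact_Icc
      ((subset_tsupport _).trans hsupp)
  · exact hsupp.trans fun x hx => ⟨hinf.1.trans_le hx.1, hx.2.trans_lt hsup.2⟩

lemma integrable_mul_of_locallyIntegrableOn {a b : ℝ} {h : ℝ → ℝ}
    (hh : LocallyIntegrableOn h (Set.Ioo a b)) {φ : ℝ → ℝ} (hφ : Continuous φ)
    (hc : HasCompactSupport φ) (hs : tsupport φ ⊆ Set.Ioo a b) :
    Integrable fun x => h x * φ x := by
  have h1 : IntegrableOn h (tsupport φ) :=
    hh.integrableOn_compact_subset hs hc.isCompact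
  have h2 : IntegrableOn (fun x => h x * φ x) (tsupport φ) :=
    h1.mul_continuousOn hφ.continuousOn hc.isCompact
  rwa [integrableOn_iff_integrable_of_support_subset] at h2
  exact (Function.support_mul_subset_right _ _).trans (subset_tsupport _)

/-- **Du Bois-Reymond's lemma**. -/
theorem exists_ae_eq_const_of_integral_mul_deriv_eq_zero {a b : ℝ} (hab : a < b) {h : ℝ → ℝ}
    (hh : LocallyIntegrableOn h (Set.Ioo a b))
    (h0 : ∀ η : ℝ → ℝ, ContDiff ℝ ∞ η → HasCompactSupport η → tsupport η ⊆ Set.Ioo a b →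
      ∫ x, h x * deriv η x = 0) :
    ∃ c : ℝ, ∀ᵐ x, x ∈ Set.Ioo a b → h x = c := by
  have hr : 0 < (b - a) / 4 := by linarith
  -- A fixed normalised bump supported in `(a, b)`; subtracting its multiple `m ρ` from a test
  -- function gives zero mean, hence an admissible derivative. The constant is then `∫ h ρ`.
  let ρ : ContDiffBump ((a + b) / 2) := ⟨(b - a) / 8, (b - a) / 4, by linarith, by linarith⟩
  have hρs : tsupport (ρ.normed volume) ⊆ Set.Ioo a b := by
    rw [ρ.tsupport_normed_eq, Real.closedBall_eq_Icc]
    intro x hx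
    have e : ρ.rOut = (b - a) / 4 := rfl
    rw [e] at hx
    exact ⟨by linarith [hx.1], by linarith [hx.2]⟩
  have hρc : HasCompactSupport (ρ.normed volume) := ρ.hasCompactSupport_normed
  have hρ : ContDiff ℝ ∞ (ρ.normed volume) := ρ.contDiff_normed
  set c := ∫ x, h x * ρ.normed volume x with hcdef
  refine ⟨c, ?_⟩
  have hfund := isOpen_Ioo.ae_eq_zero_of_integral_contDiff_smul_eq_zero (μ := volume)
    (f := fun x => h x - c) (U := Set.Ioo a b) (hh.sub (locallyIntegrableOn_const c)) ?_
  · filter_upwards [hfund] with x hx hxI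
    exact sub_eq_zero.1 (hx hxI)
  intro ψ hψ hψc hψs
  set m := ∫ x, ψ x with hm
  have hψi : Integrable ψ := hψ.continuous.integrable_of_hasCompactSupport hψc
  have hρi : Integrable (ρ.normed volume) := hρ.continuous.integrable_of_hasCompactSupport hρc
  have hmρc : HasCompactSupport fun x => m * ρ.normed volume x := hρc.mul_left
  obtain ⟨Z, hZ, hZc, hZs, hZd⟩ := exists_primitive_of_integral_eq_zero (a := a) (b := b)
    (ζ := fun x => ψ x - m * ρ.normed volume x) (hψ.sub (contDiff_const.mul hρ))
    (hψc.sub hmρc) (by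
      refine (tsupport_sub _ _).trans (Set.union_subset hψs ?_)
      exact (closure_mono (Function.support_mul_subset_right _ _)).trans hρs)
    (by rw [integral_sub hψi (hρi.const_mul m), integral_const_mul, ρ.integral_normed, hm]; ring)
  have hz := h0 Z hZ hZc hZs
  rw [hZd] at hz
  have i1 := integrable_mul_of_locallyIntegrableOn hh hψ.continuous hψc hψs
  have i2 := integrable_mul_of_locallyIntegrableOn hh hρ.continuous hρc hρs
  have e1 : ∫ x, h x * (ψ x - m * ρ.normed volume x) = (∫ x, h x * ψ x) - m * c := by
    rw [hcdef, ← integral_const_mul, ← integral_sub i1 (i2.const_mul m)]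
    refine integral_congr_ae (ae_of_all _ fun x => by simp only; ring)
  have e2 : ∫ x, ψ x • (h x - c) = (∫ x, h x * ψ x) - m * c := by
    rw [mul_comm m, hm, ← integral_const_mul, ← integral_sub i1 (hψi.const_mul c)]
    refine integral_congr_ae (ae_of_all _ fun x => by simp only [smul_eq_mul]; ring)
  rw [e2, ← e1, hz]

/-! ### Radial test functions and the classical profile -/

section RadialTest

variable {N : ℕ} {R : ℝ} {η : ℝ → ℝ}

/-- The norm is not smooth at the origin, but the support of `η` avoids `0`. -/
lemma isTestFunction_radial (hη : ContDiff ℝ ∞ η)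
    (hs : tsupport η ⊆ Set.Ioo 0 R) :
    IsTestFunction (Metric.ball (0 : EuclideanSpace ℝ (Fin N)) R) fun x => η ‖x‖ := by
  have hsub : tsupport (fun x : EuclideanSpace ℝ (Fin N) => η ‖x‖) ⊆
      (fun x => ‖x‖) ⁻¹' tsupport η :=
    tsupport_comp_subset_preimage η continuous_norm
  refine ⟨?_, ?_, fun x hx => ?_⟩
  · refine contDiff_iff_contDiffAt.2 fun x => ?_
    by_cases hx : x ∈ tsupport fun x : EuclideanSpace ℝ (Fin N) => η ‖x‖
    swap
    · exact contDiffAt_const.congr_of_eventuallyEq (notMem_tsupport_iff_eventuallyEq.1 hx)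
    have hx0 : x ≠ 0 := norm_pos_iff.1 (hs (hsub hx)).1
    exact hη.contDiffAt.comp x (contDiffAt_norm ℝ hx0)
  · refine HasCompactSupport.of_support_subset_isCompact
      (isCompact_closedBall (0 : EuclideanSpace ℝ (Fin N)) R) fun x hx => ?_
    simpa using (hs (hsub (subset_tsupport _ hx))).2.le
  · simpa using (hs (hsub hx)).2

lemma gradient_radial (hη : Differentiable ℝ η) {x : EuclideanSpace ℝ (Fin N)} (hx : x ≠ 0) :
    gradient (fun x : EuclideanSpace ℝ (Fin N) => η ‖x‖) x = (deriv η ‖x‖ / ‖x‖) • x := by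
  have h := (hη ‖x‖).hasDerivAt.comp_hasFDerivAt x (hasFDerivAt_norm_of_ne hx)
  refine HasGradientAt.gradient ?_
  rw [hasGradientAt_iff_hasFDerivAt]
  convert! h using 1
  ext y
  simp
  ring

/-- The weak formulation tested with radial functions, in polar coordinates. -/
lemma radial_weak_form [Nontrivial (EuclideanSpace ℝ (Fin N))] {p μ q s lam : ℝ} {f g : ℝ → ℝ}
    {u : EuclideanSpace ℝ (Fin N) → ℝ} {G : EuclideanSpace ℝ (Fin N) → EuclideanSpace ℝ (Fin N)}
    (hu : ∀ᵐ x ∂(volume.restrict (Metric.ball (0 : EuclideanSpace ℝ (Fin N)) R)), u x = f ‖x‖)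
    (hG : ∀ᵐ x ∂(volume.restrict (Metric.ball (0 : EuclideanSpace ℝ (Fin N)) R)),
      G x = (g ‖x‖ / ‖x‖) • x)
    (hη : ContDiff ℝ ∞ η) (hs : tsupport η ⊆ Set.Ioo 0 R)
    (hweak : ∫ x in Metric.ball (0 : EuclideanSpace ℝ (Fin N)) R,
          (‖G x‖ ^ (p - 2) * inner ℝ (G x) (gradient (fun x => η ‖x‖) x)
            - μ / ‖x‖ ^ p * (|u x| ^ (p - 2) * u x) * η ‖x‖
            - lam * (|u x| ^ (p - 2) * u x) * η ‖x‖)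
        = ∫ x in Metric.ball (0 : EuclideanSpace ℝ (Fin N)) R,
            |u x| ^ (q - 2) * u x / ‖x‖ ^ s * η ‖x‖) :
    ∫ r in Set.Ioi (0 : ℝ), r ^ (N - 1) *
        (oddPow p (g r) * deriv η r - (μ / r ^ p + lam) * oddPow p (f r) * η r) =
      ∫ r in Set.Ioi (0 : ℝ), r ^ (N - 1) * (oddPow q (f r) / r ^ s * η r) := by
  set B := Metric.ball (0 : EuclideanSpace ℝ (Fin N)) R with hB
  have hη0 : ∀ r, r ∉ Set.Ioo 0 R → η r = 0 := fun r hr =>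
    image_eq_zero_of_notMem_tsupport fun h => hr (hs h)
  have hη'0 : ∀ r, r ∉ Set.Ioo 0 R → deriv η r = 0 := fun r hr =>
    image_eq_zero_of_notMem_tsupport fun h => hr (hs (tsupport_deriv_subset h))
  have hη' : Differentiable ℝ η := hη.differentiable (by simp)
  have hx0 : ∀ᵐ x ∂(volume.restrict B), x ≠ 0 := ae_restrict_of_ae (by simp [ae_iff])
  have e1 : ∫ x in B, (‖G x‖ ^ (p - 2) * inner ℝ (G x) (gradient (fun x => η ‖x‖) x)
            - μ / ‖x‖ ^ p * (|u x| ^ (p - 2) * u x) * η ‖x‖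
            - lam * (|u x| ^ (p - 2) * u x) * η ‖x‖) =
      ∫ x : EuclideanSpace ℝ (Fin N), (fun r => oddPow p (g r) * deriv η r -
        (μ / r ^ p + lam) * oddPow p (f r) * η r) ‖x‖ := by
    refine Eq.trans ?_ (setIntegral_eq_integral_of_forall_compl_eq_zero (s := B) ?_)
    · refine integral_congr_ae ?_
      filter_upwards [hu, hG, hx0] with x h1 h2 h3
      rw [h1, h2, gradient_radial hη' h3]
      have hn : ‖x‖ ≠ 0 := norm_ne_zero_iff.2 h3
      have e : ‖(g ‖x‖ / ‖x‖) • x‖ = |g ‖x‖| := by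
        rw [norm_smul, norm_div, norm_norm, div_mul_cancel₀ _ hn, Real.norm_eq_abs]
      rw [e, inner_smul_left, inner_smul_right, real_inner_self_eq_norm_sq]
      simp only [oddPow, conj_trivial]
      field_simp
      ring
    · intro x hx
      have hx' : ‖x‖ ∉ Set.Ioo 0 R := fun h => hx (by simpa [hB] using h.2)
      simp [hη0 _ hx', hη'0 _ hx']
  have e2 : ∫ x in B, |u x| ^ (q - 2) * u x / ‖x‖ ^ s * η ‖x‖ =
      ∫ x : EuclideanSpace ℝ (Fin N), (fun r => oddPow q (f r) / r ^ s * η r) ‖x‖ := by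
    refine Eq.trans ?_ (setIntegral_eq_integral_of_forall_compl_eq_zero (s := B) ?_)
    · refine integral_congr_ae ?_
      filter_upwards [hu] with x h1
      rw [h1, oddPow]
    · intro x hx
      have hx' : ‖x‖ ∉ Set.Ioo 0 R := fun h => hx (by simpa [hB] using h.2)
      simp [hη0 _ hx']
  have p1 := integral_fun_norm_addHaar (volume : Measure (EuclideanSpace ℝ (Fin N)))
    (fun r => oddPow p (g r) * deriv η r - (μ / r ^ p + lam) * oddPow p (f r) * η r)
  have p2 := integral_fun_norm_addHaar (volume : Measure (EuclideanSpace ℝ (Fin N)))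
    (fun r => oddPow q (f r) / r ^ s * η r)
  have hpol := (e1.trans p1).symm.trans (hweak.trans (e2.trans p2))
  rw [finrank_euclideanSpace_fin, ← smul_assoc, ← smul_assoc] at hpol
  have hN : N ≠ 0 := by
    have := Module.finrank_pos (R := ℝ) (M := EuclideanSpace ℝ (Fin N))
    rw [finrank_euclideanSpace_fin] at this
    exact this.ne'
  -- The common factor `N · vol(B₁)` from polar integration is nonzero and cancels.
  have hK : N • (volume : Measure (EuclideanSpace ℝ (Fin N))).real (Metric.ball 0 1) ≠ 0 := by
    have : 0 < (volume : Measure (EuclideanSpace ℝ (Fin N))).real (Metric.ball 0 1) :=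
      ENNReal.toReal_pos (Metric.measure_ball_pos _ _ one_pos).ne' measure_ball_lt_top.ne
    simp [hN, this.ne']
  exact smul_right_injective _ hK hpol

end RadialTest

/-- If `A' = -b` weakly on `(0, R)` with `b` continuous, then `A` agrees almost everywhere with
a classical solution. -/
lemma exists_hasDerivAt_ae_eq {A b : ℝ → ℝ} {R : ℝ} (hR : 0 < R)
    (hA : LocallyIntegrableOn A (Set.Ioo 0 R)) (hb : ContinuousOn b (Set.Ioi 0))
    (h : ∀ η : ℝ → ℝ, ContDiff ℝ ∞ η → HasCompactSupport η → tsupport η ⊆ Set.Ioo 0 R →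
      ∫ r, A r * deriv η r = ∫ r, b r * η r) :
    ∃ F : ℝ → ℝ, (∀ r > 0, HasDerivAt F (-b r) r) ∧ ∀ᵐ r, r ∈ Set.Ioo 0 R → A r = F r := by
  have hd : ∀ r > 0, HasDerivAt (fun r => -∫ t in R..r, b t) (-b r) r := by
    intro r hr
    have hsub : Set.uIcc R r ⊆ Set.Ioi 0 := fun t ht => lt_of_lt_of_le (lt_min hR hr) ht.1
    exact (intervalIntegral.integral_hasDerivAt_right (hb.mono hsub).intervalIntegrable
      (hb.stronglyMeasurableAtFilter isOpen_Ioi r hr) (hb.continuousAt (Ioi_mem_nhds hr))).neg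
  set F₀ : ℝ → ℝ := fun r => -∫ t in R..r, b t with hF₀
  have hF₀c : ContinuousOn F₀ (Set.Ioo 0 R) :=
    fun r hr => (hd r hr.1).continuousAt.continuousWithinAt
  have hF₀l : LocallyIntegrableOn F₀ (Set.Ioo 0 R) := hF₀c.locallyIntegrableOn measurableSet_Ioo
  have hbl : LocallyIntegrableOn b (Set.Ioo 0 R) :=
    (hb.mono fun r hr => hr.1).locallyIntegrableOn measurableSet_Ioo
  -- The classical primitive `F₀` of `-b` has the same weak derivative as `A`, so `A - F₀` is
  -- constant.
  obtain ⟨c, hc⟩ := exists_ae_eq_const_of_integral_mul_deriv_eq_zero hR (hA.sub hF₀l) (by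
    intro η hη hηc hηs
    have hη'c : HasCompactSupport (deriv η) := hηc.deriv
    have hη's : tsupport (deriv η) ⊆ Set.Ioo 0 R :=
      tsupport_deriv_subset.trans hηs
    have hη' : Continuous (deriv η) := hη.continuous_deriv (by simp)
    have i1 := integrable_mul_of_locallyIntegrableOn hA hη' hη'c hη's
    have i2 := integrable_mul_of_locallyIntegrableOn hF₀l hη' hη'c hη's
    have i3 := integrable_mul_of_locallyIntegrableOn hF₀l hη.continuous hηc hηs
    have i4 := integrable_mul_of_locallyIntegrableOn hbl hη.continuous hηc hηs
    have hparts : ∫ r, F₀ r * deriv η r = -∫ r, (-b r) * η r :=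
      integral_mul_deriv_eq_deriv_mul_of_integrable (fun r hr => hd r (hηs hr).1)
        (fun r _ => (hη.differentiable (by simp) r).hasDerivAt) i2
        (by simpa [Pi.mul_def] using i4.neg) i3
    have e : ∫ r, (A r - F₀ r) * deriv η r = (∫ r, A r * deriv η r) - ∫ r, F₀ r * deriv η r := by
      rw [← integral_sub i1 i2]
      exact integral_congr_ae (ae_of_all _ fun r => by simp only; ring)
    change ∫ r, (A r - F₀ r) * deriv η r = 0
    rw [e, h η hη hηc hηs, hparts]
    simp [integral_neg])
  refine ⟨fun r => F₀ r + c, fun r hr => (hd r hr).add_const c, ?_⟩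
  filter_upwards [hc] with r hr hrI
  have := hr hrI
  simp only [Pi.sub_apply] at this
  linarith

/-- A positive radial weak solution has a classical radial profile `f` with flux
`F(r) = r^(N-1) |f'|^(p-2) f'`. -/
theorem IsPositiveRadialSolution.exists_profile {N : ℕ} [Nontrivial (EuclideanSpace ℝ (Fin N))]
    {p μ s lam R : ℝ} (hp : 1 < p) (hq : 1 < critExp N p s) (hR : 0 < R)
    {u : EuclideanSpace ℝ (Fin N) → ℝ} (h : IsPositiveRadialSolution p μ s lam R u) :
    ∃ f F : ℝ → ℝ,
      (∀ᵐ x ∂(volume.restrict (Metric.ball (0 : EuclideanSpace ℝ (Fin N)) R)), u x = f ‖x‖) ∧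
      (∀ r ∈ Set.Ioo 0 R, HasDerivAt f (oddPow (p / (p - 1)) (F r / r ^ (N - 1))) r) ∧
      (∀ r ∈ Set.Ioo 0 R, HasDerivAt F (-(r ^ (N - 1) * ((μ / r ^ p + lam) * oddPow p (f r) +
        oddPow (critExp N p s) (f r) / r ^ s))) r) ∧
      Tendsto f (𝓝[<] R) (𝓝 0) ∧ (∃ L, Tendsto F (𝓝[<] R) (𝓝 L)) ∧
      (∀ᵐ r ∂(volume.restrict (Set.Ioo 0 R)), 0 < f r) ∧
      IntegrableOn (fun r => r ^ (N - 1) * |F r / r ^ (N - 1)| ^ (p / (p - 1))) (Set.Ioo 0 R) := by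
  obtain ⟨⟨G, hmem, hweak⟩, hpos, f₀, hf₀⟩ := h
  set B := Metric.ball (0 : EuclideanSpace ℝ (Fin N)) R with hB
  have hBm : MeasurableSet B := measurableSet_ball
  have hfinm : IsFiniteMeasure (volume.restrict B) := ⟨by
    rw [Measure.restrict_apply_univ]; exact measure_ball_lt_top⟩
  have hx0 : ∀ᵐ x ∂(volume.restrict B), x ≠ 0 := ae_restrict_of_ae (by simp [ae_iff])
  obtain ⟨g₀, hg₀, hu₀⟩ := hmem.exists_radial_primitive hp.le hR hf₀
  -- Extended by zero past `R`, so that `f` is continuous on all of `(0, ∞)` and its limit at `R` is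
  -- simply its value `0`.
  set g := (Set.Ioo 0 R).indicator g₀ with hg
  set f : ℝ → ℝ := fun r => -∫ t in r..R, g t with hf
  have hgi : ∀ ε > 0, IntegrableOn g (Set.Ioi ε) := by
    intro ε hε
    rw [hg, integrableOn_indicator_iff measurableSet_Ioo]
    refine (hg₀ ε hε).mono_set fun r hr => ⟨hr.2, hr.1.2⟩
  have hu : ∀ᵐ x ∂(volume.restrict B), u x = f ‖x‖ := by
    filter_upwards [hu₀, hx0, ae_restrict_mem hBm] with x h1 h2 h3
    have hx : 0 < ‖x‖ := norm_pos_iff.2 h2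
    have hxR : ‖x‖ < R := by simpa [hB] using h3
    rw [h1, hf]
    simp only
    congr 1
    rw [intervalIntegral.integral_of_le hxR.le, intervalIntegral.integral_of_le hxR.le,
      ← restrict_Ioo_eq_restrict_Ioc]
    refine setIntegral_congr_fun measurableSet_Ioo fun t ht => ?_
    rw [hg, Set.indicator_of_mem (show t ∈ Set.Ioo 0 R from ⟨hx.trans ht.1, ht.2⟩)]
  have hfc : ContinuousOn f (Set.Ioi 0) := by
    intro r₀ hr₀
    have hr₀' : (0 : ℝ) < r₀ := hr₀
    set m := min r₀ R / 2 with hm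
    have hm0 : 0 < m := by have := lt_min hr₀' hR; positivity
    have hmr : m < r₀ := by have := min_le_left r₀ R; have := lt_min hr₀' hR; linarith
    have hmR : m < R := by have := min_le_right r₀ R; have := lt_min hr₀' hR; linarith
    have hint : Integrable ((Set.Ioi m).indicator g) :=
      (hgi m hm0).integrable_indicator measurableSet_Ioi
    have hc := intervalIntegral.continuous_primitive
      (fun a b => hint.intervalIntegrable (a := a) (b := b)) R
    refine ContinuousAt.continuousWithinAt (hc.continuousAt.congr ?_)
    filter_upwards [Ioi_mem_nhds hmr] with r hr
    rw [hf]
    simp only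
    rw [← intervalIntegral.integral_symm]
    refine intervalIntegral.integral_congr fun t ht => ?_
    have : m < t := lt_of_lt_of_le (lt_min hmR hr) ht.1
    rw [Set.indicator_of_mem (Set.mem_Ioi.2 this)]
  have hp' : (1 : ENNReal) ≤ ENNReal.ofReal p := by
    rw [← ENNReal.ofReal_one]; exact ENNReal.ofReal_le_ofReal hp.le
  have hG : ∀ᵐ x ∂(volume.restrict B), G x = (g ‖x‖ / ‖x‖) • x := by
    refine hmem.hasWeakGradient.eq_of_radial (hmem.memLp_grad.integrable hp') (fun ε hε => ?_) hu
    exact (hgi ε hε).mono_set fun r hr => hr.1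
  have hgp : IntegrableOn (fun r => r ^ (N - 1) * |g r| ^ p) (Set.Ioo 0 R) := by
    have h1 := hmem.memLp_grad.integrable_norm_rpow (by simp; linarith) ENNReal.ofReal_ne_top
    rw [ENNReal.toReal_ofReal (by linarith)] at h1
    have h2 : IntegrableOn (fun x : EuclideanSpace ℝ (Fin N) => |g ‖x‖| ^ p) B := by
      refine h1.congr ?_
      filter_upwards [hG, hx0] with x h3 h4
      rw [h3, norm_smul, norm_div, norm_norm, div_mul_cancel₀ _ (norm_ne_zero_iff.2 h4),
        Real.norm_eq_abs]
    have h3 := (integrableOn_fun_norm_addHaar volume (f := fun r => |g r| ^ p)).1 h2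
    rwa [finrank_euclideanSpace_fin] at h3
  set q := critExp N p s with hqdef
  set b₁ : ℝ → ℝ := fun r => r ^ (N - 1) * ((μ / r ^ p + lam) * oddPow p (f r)) with hb₁
  set b₂ : ℝ → ℝ := fun r => r ^ (N - 1) * (oddPow q (f r) / r ^ s) with hb₂
  have hrpow : ∀ a : ℝ, ContinuousOn (fun r : ℝ => r ^ a) (Set.Ioi 0) := fun a =>
    continuousOn_id.rpow_const fun r hr => Or.inl (ne_of_gt hr)
  have hrne : ∀ a : ℝ, ∀ r ∈ Set.Ioi (0 : ℝ), r ^ a ≠ 0 := fun a r hr =>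
    (Real.rpow_pos_of_pos hr a).ne'
  have hnpow : ContinuousOn (fun r : ℝ => r ^ (N - 1)) (Set.Ioi 0) := by fun_prop
  have hb₁c : ContinuousOn b₁ (Set.Ioi 0) :=
    hnpow.mul (((continuousOn_const.div (hrpow p) (hrne p)).add continuousOn_const).mul
      ((continuous_oddPow hp).comp_continuousOn hfc))
  have hb₂c : ContinuousOn b₂ (Set.Ioi 0) :=
    hnpow.mul (((continuous_oddPow hq).comp_continuousOn hfc).div (hrpow s) (hrne s))
  set A : ℝ → ℝ := fun r => r ^ (N - 1) * oddPow p (g r) with hA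
  have hAl : LocallyIntegrableOn A (Set.Ioo 0 R) := by
    intro x hx
    refine ⟨Set.Ioo (x / 2) R, mem_nhdsWithin_of_mem_nhds
      (Ioo_mem_nhds (by linarith [hx.1]) hx.2), ?_⟩
    have hsub : Set.Ioo (x / 2) R ⊆ Set.Ioo 0 R := Set.Ioo_subset_Ioo_left (by linarith [hx.1])
    have h1 : IntegrableOn (fun r : ℝ => r ^ (N - 1)) (Set.Ioo (x / 2) R) :=
      ((continuous_pow (N - 1)).continuousOn.integrableOn_Icc).mono_set Set.Ioo_subset_Icc_self
    -- The majorant is `r^(N-1) (1 + |g|^p)`, because `|g|^(p-1) ≤ 1 + |g|^p`.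
    refine Integrable.mono' (h1.add (hgp.mono_set hsub)) ?_ ?_
    · have h2 : AEStronglyMeasurable g (volume.restrict (Set.Ioo (x / 2) R)) :=
        ((hgi (x / 2) (by linarith [hx.1])).mono_set fun r hr => hr.1).aestronglyMeasurable
      exact (continuous_pow (N - 1)).aestronglyMeasurable.mul
        ((continuous_oddPow hp).comp_aestronglyMeasurable h2)
    · filter_upwards [ae_restrict_mem measurableSet_Ioo] with r hr
      have hr0 : 0 < r := (hsub hr).1
      simp only [hA, Pi.add_apply]
      rw [Real.norm_eq_abs, abs_mul, abs_of_pos (pow_pos hr0 _), abs_oddPow hp,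
        ← mul_one_add]
      refine mul_le_mul_of_nonneg_left ?_ (by positivity)
      rcases le_total |g r| 1 with hle | hge
      · have := Real.rpow_le_one (abs_nonneg (g r)) hle (by linarith : 0 ≤ p - 1)
        have h3 : 0 ≤ |g r| ^ p := by positivity
        linarith
      · have := Real.rpow_le_rpow_of_exponent_le hge (by linarith : p - 1 ≤ p)
        linarith
  obtain ⟨F, hFd, hFA⟩ := exists_hasDerivAt_ae_eq hR hAl (hb₁c.add hb₂c) (by
    intro η hη hηc hηs
    have hw := radial_weak_form (N := N) hu hG hη hηs (hweak _ (isTestFunction_radial hη hηs))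
    have hη0 : ∀ r, r ∉ Set.Ioi (0 : ℝ) → η r = 0 := fun r hr =>
      image_eq_zero_of_notMem_tsupport fun h => hr (hηs h).1
    have hη'0 : ∀ r, r ∉ Set.Ioi (0 : ℝ) → deriv η r = 0 := fun r hr =>
      image_eq_zero_of_notMem_tsupport fun h => hr (hηs (tsupport_deriv_subset h)).1
    have hη'c : HasCompactSupport (deriv η) := hηc.deriv
    have hη' : Continuous (deriv η) := hη.continuous_deriv (by simp)
    have hloc : ∀ {b : ℝ → ℝ}, ContinuousOn b (Set.Ioi 0) → LocallyIntegrableOn b (Set.Ioo 0 R) :=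
      fun hb => (hb.mono fun r hr => hr.1).locallyIntegrableOn measurableSet_Ioo
    have i1 := integrable_mul_of_locallyIntegrableOn hAl hη' hη'c
      (tsupport_deriv_subset.trans hηs)
    have i2 := integrable_mul_of_locallyIntegrableOn (hloc hb₁c) hη.continuous hηc hηs
    have i3 := integrable_mul_of_locallyIntegrableOn (hloc hb₂c) hη.continuous hηc hηs
    rw [setIntegral_eq_integral_of_forall_compl_eq_zero
        (fun r hr => by rw [hη0 r hr, hη'0 r hr]; ring),
      setIntegral_eq_integral_of_forall_compl_eq_zero (fun r hr => by rw [hη0 r hr]; ring)] at hw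
    have e1 : ∫ r, r ^ (N - 1) * (oddPow p (g r) * deriv η r -
        (μ / r ^ p + lam) * oddPow p (f r) * η r) =
        (∫ r, A r * deriv η r) - ∫ r, b₁ r * η r := by
      rw [← integral_sub i1 i2]
      exact integral_congr_ae (ae_of_all _ fun r => by simp only [hA, hb₁]; ring)
    have e2 : ∫ r, r ^ (N - 1) * (oddPow q (f r) / r ^ s * η r) = ∫ r, b₂ r * η r :=
      integral_congr_ae (ae_of_all _ fun r => by simp only [hb₂]; ring)
    have e3 : ∫ r, (b₁ + b₂) r * η r = (∫ r, b₁ r * η r) + ∫ r, b₂ r * η r := by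
      rw [← integral_add i2 i3]
      exact integral_congr_ae (ae_of_all _ fun r => by simp only [Pi.add_apply]; ring)
    change _ = ∫ r, (b₁ + b₂) r * η r
    rw [e3, ← e2, ← hw, e1]
    ring)
  have hpc : ((p / (p - 1)) - 1) * (p - 1) = 1 := by
    have : p - 1 ≠ 0 := by linarith
    field_simp
    ring
  have hp1 : 1 < p / (p - 1) := EmdenFowler.one_lt_conj hp
  -- The continuous representative of `g`, obtained by inverting the odd power in the flux;
  -- replacing `g` by `k` under the integral makes `f` continuously differentiable.
  set k : ℝ → ℝ := fun r => oddPow (p / (p - 1)) (F r / r ^ (N - 1)) with hk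
  have hFc : ContinuousOn F (Set.Ioi 0) := fun r hr => (hFd r hr).continuousAt.continuousWithinAt
  have hkc : ContinuousOn k (Set.Ioi 0) := (continuous_oddPow hp1).comp_continuousOn
    (hFc.div hnpow fun r hr => (pow_pos hr _).ne')
  have hFg : ∀ᵐ r, r ∈ Set.Ioo 0 R → F r / r ^ (N - 1) = oddPow p (g r) := by
    filter_upwards [hFA] with r hr hrI
    rw [← hr hrI, hA, mul_div_cancel_left₀ _ (pow_pos hrI.1 _).ne']
  have hgk : ∀ᵐ r, r ∈ Set.Ioo 0 R → g r = k r := by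
    filter_upwards [hFg] with r hr hrI
    rw [hk]
    simp only
    rw [hr hrI, oddPow_oddPow hp1 hpc]
  refine ⟨f, F, hu, ?_, ?_, ?_, ?_, ?_, ?_⟩
  · intro r hr
    have hfk : ∀ r ∈ Set.Ioo 0 R, f r = -∫ t in r..R, k t := by
      intro r hr
      rw [hf]
      simp only
      congr 1
      rw [intervalIntegral.integral_of_le hr.2.le, intervalIntegral.integral_of_le hr.2.le,
        ← restrict_Ioo_eq_restrict_Ioc]
      refine setIntegral_congr_ae measurableSet_Ioo ?_
      filter_upwards [hgk] with t ht htI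
      exact ht ⟨hr.1.trans htI.1, htI.2⟩
    have hsub : Set.uIcc r R ⊆ Set.Ioi 0 := fun t ht => lt_of_lt_of_le (lt_min hr.1 hR) ht.1
    have hd := (intervalIntegral.integral_hasDerivAt_left (hkc.mono hsub).intervalIntegrable
      (hkc.stronglyMeasurableAtFilter isOpen_Ioi r hr.1)
      (hkc.continuousAt (Ioi_mem_nhds hr.1))).neg
    rw [neg_neg] at hd
    refine hd.congr_of_eventuallyEq ?_
    filter_upwards [Ioo_mem_nhds hr.1 hr.2] with t ht using hfk t ht
  · intro r hr
    refine (hFd r hr.1).congr_deriv ?_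
    simp only [hb₁, hb₂, Pi.add_apply]
    ring
  · have h1 := (hfc.continuousAt (Ioi_mem_nhds hR)).tendsto.mono_left
      (nhdsWithin_le_nhds (s := Set.Iio R))
    simpa [hf] using h1
  · exact ⟨F R, (hFc.continuousAt (Ioi_mem_nhds hR)).tendsto.mono_left nhdsWithin_le_nhds⟩
  · have h1 : ∀ᵐ x : EuclideanSpace ℝ (Fin N), x ∈ B → 0 < f ‖x‖ := by
      rw [← ae_restrict_iff' hBm]
      filter_upwards [hpos, hu] with x h2 h3
      rwa [← h3]
    have hneBot : (ae (volume : Measure (EuclideanSpace ℝ (Fin N))).toSphere).NeBot :=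
      ae_neBot.2 (Measure.toSphere_ne_zero _)
    obtain ⟨θ, hθ⟩ := (ae_toSphere_of_ae volume h1).exists
    have hθn : ‖θ.1‖ = 1 := by simp
    have h2 := (ae_restrict_iff' measurableSet_Ioi).1 hθ
    rw [ae_restrict_iff' measurableSet_Ioo]
    filter_upwards [h2] with r hr hrI
    have h3 : ‖r • θ.1‖ = r := by
      rw [norm_smul, hθn, mul_one, Real.norm_eq_abs, abs_of_pos hrI.1]
    have h4 := hr hrI.1 (by simpa [hB, h3] using hrI.2)
    rwa [h3] at h4
  · refine hgp.congr_fun_ae ?_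
    filter_upwards [ae_restrict_of_ae hFg, ae_restrict_mem measurableSet_Ioo] with r hr hrI
    rw [hr hrI, abs_oddPow hp, ← Real.rpow_mul (abs_nonneg _)]
    congr 2
    have : p - 1 ≠ 0 := by linarith
    field_simp

/-! ### Change of variables and conclusion -/

/-- The Emden–Fowler change of variables `t = log r`, `w(t) = r^δ f(r)`, `P(t) = r^(-δ) F(r)`. -/
theorem emdenFowler_of_profile {N : ℕ} {p μ s lam R : ℝ} (hp : 1 < p) (hpN : p < N)
    (hq : 1 < critExp N p s) (hR : 0 < R) {f F : ℝ → ℝ}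
    (hf : ∀ r ∈ Set.Ioo 0 R, HasDerivAt f (oddPow (p / (p - 1)) (F r / r ^ (N - 1))) r)
    (hF : ∀ r ∈ Set.Ioo 0 R, HasDerivAt F (-(r ^ (N - 1) * ((μ / r ^ p + lam) * oddPow p (f r) +
        oddPow (critExp N p s) (f r) / r ^ s))) r)
    (hf0 : Tendsto f (𝓝[<] R) (𝓝 0)) (hFL : ∃ L, Tendsto F (𝓝[<] R) (𝓝 L))
    (hpos : ∀ᵐ r ∂(volume.restrict (Set.Ioo 0 R)), 0 < f r)
    (hint : IntegrableOn (fun r => r ^ (N - 1) * |F r / r ^ (N - 1)| ^ (p / (p - 1)))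
      (Set.Ioo 0 R)) :
    EmdenFowler p ((N - p) / p) μ (critExp N p s) lam (Real.log R)
      (fun t => Real.exp ((N - p) / p * t) * f (Real.exp t))
      (fun t => Real.exp (-((N - p) / p * t)) * F (Real.exp t)) := by
  have hp0 : p ≠ 0 := by linarith
  have hp1 : p - 1 ≠ 0 := by linarith
  have hN1 : 1 ≤ N := by
    have : (1 : ℝ) < N := hp.trans hpN
    exact_mod_cast this.le
  have hNp : (N : ℝ) - p ≠ 0 := by linarith
  have hp' := EmdenFowler.one_lt_conj hp
  set δ := ((N : ℝ) - p) / p with hδ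
  set q := critExp N p s with hqdef
  have hδq : δ * q = N - s := by rw [hδ, hqdef, critExp]; field_simp
  have hexp : ∀ t < Real.log R, Real.exp t ∈ Set.Ioo 0 R := fun t ht =>
    ⟨Real.exp_pos t, (Real.lt_log_iff_exp_lt hR).1 ht⟩
  have hpow : ∀ t : ℝ, Real.exp t ^ (N - 1) = Real.exp ((N - 1) * t) := by
    intro t
    rw [← Real.exp_nat_mul, Nat.cast_sub hN1, Nat.cast_one]
  have hrpow : ∀ t a : ℝ, Real.exp t ^ a = Real.exp (a * t) := by
    intro t a
    rw [← Real.exp_mul, mul_comm]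
  -- Rewrites `P` through `F / r^(N-1)`, the argument of the odd power in `f'`. The exponent
  -- satisfies `(p'-1)(N-1-δ) = δ + 1` and `p'(N-1-δ) = N`, which give the first equation and the
  -- integrability of `|P|^p'`.
  have hP : ∀ t : ℝ, Real.exp (-(δ * t)) * F (Real.exp t) =
      Real.exp ((N - 1 - δ) * t) * (F (Real.exp t) / Real.exp t ^ (N - 1)) := by
    intro t
    rw [hpow, div_eq_mul_inv, ← Real.exp_neg,
      show -(δ * t) = (N - 1 - δ) * t + -((N - 1) * t) by ring, Real.exp_add]
    ring
  have hdense : ∀ c d, 0 ≤ c → c < d → d ≤ R → ∃ r ∈ Set.Ioo c d, 0 < f r := by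
    intro c d hc hcd hd
    by_contra! hcon
    have h1 : ∀ᵐ r ∂(volume.restrict (Set.Ioo c d)), False := by
      have h2 := ae_restrict_of_ae_restrict_of_subset (Set.Ioo_subset_Ioo hc hd) hpos
      filter_upwards [h2, ae_restrict_mem measurableSet_Ioo] with r h3 h4
      exact absurd h3 (not_lt.2 (hcon r h4))
    rw [eventually_false_iff_eq_bot, ae_eq_bot, Measure.restrict_eq_zero, Real.volume_Ioo,
      ENNReal.ofReal_eq_zero] at h1
    linarith
  -- Positivity almost everywhere and continuity give only nonnegativity everywhere; strict
  -- positivity on a dense set is recorded separately.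
  have hnonneg : ∀ r ∈ Set.Ioo 0 R, 0 ≤ f r := by
    intro r hr
    by_contra! hneg
    have h1 : ∀ᶠ x in 𝓝 r, f x < 0 := (hf r hr).continuousAt.eventually_lt_const hneg
    obtain ⟨c, d, hrcd, hsub⟩ := mem_nhds_iff_exists_Ioo_subset.1
      (h1.and (Ioo_mem_nhds hr.1 hr.2))
    obtain ⟨x, hx, hfx⟩ := hdense (max c 0) (min d R) (le_max_right _ _)
      (by simp only [max_lt_iff, lt_min_iff]
          exact ⟨⟨hrcd.1.trans hrcd.2, hr.1.trans hrcd.2⟩, ⟨hrcd.1.trans hr.2, hR⟩⟩)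
      (min_le_right _ _)
    have := (hsub ⟨(le_max_left _ _).trans_lt hx.1, hx.2.trans_le (min_le_left _ _)⟩).1
    linarith
  have hlim : Tendsto Real.exp (𝓝[<] (Real.log R)) (𝓝[<] R) := by
    refine tendsto_nhdsWithin_iff.2 ⟨?_, ?_⟩
    · have := Real.continuous_exp.tendsto (Real.log R)
      rw [Real.exp_log hR] at this
      exact this.mono_left nhdsWithin_le_nhds
    · filter_upwards [self_mem_nhdsWithin] with t ht using (hexp t ht).2
  refine ⟨?_, ?_, ?_, ?_, ?_, ?_, ?_⟩
  · intro t ht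
    have h1 : HasDerivAt (fun t => Real.exp (δ * t)) (Real.exp (δ * t) * δ) t := by
      simpa using ((hasDerivAt_id t).const_mul δ).exp
    have h2 := (hf _ (hexp t ht)).comp t (Real.hasDerivAt_exp t)
    refine (h1.mul h2).congr_deriv ?_
    rw [hP, oddPow_mul hp' (Real.exp_pos _).le, hrpow]
    have e : (p / (p - 1) - 1) * ((N - 1 - δ) * t) = δ * t + t := by
      rw [hδ]; field_simp; ring
    rw [e, Real.exp_add]
    simp only [Function.comp_apply]
    ring
  · intro t ht
    have h1 : HasDerivAt (fun t => Real.exp (-(δ * t))) (Real.exp (-(δ * t)) * -δ) t := by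
      simpa using ((hasDerivAt_id t).const_mul δ).neg.exp
    have h2 := (hF _ (hexp t ht)).comp t (Real.hasDerivAt_exp t)
    refine (h1.mul h2).congr_deriv ?_
    have hf0 := hnonneg _ (hexp t ht)
    rw [oddPow_of_nonneg hp hf0, oddPow_of_nonneg hq hf0, Real.mul_rpow (Real.exp_pos _).le hf0,
      Real.mul_rpow (Real.exp_pos _).le hf0, hpow, hrpow, hrpow, hrpow, hrpow]
    simp only [Function.comp_apply]
    have e1 : Real.exp (-(δ * t)) * Real.exp ((N - 1) * t) * Real.exp t =
        Real.exp (p * t) * Real.exp ((p - 1) * (δ * t)) := by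
      rw [← Real.exp_add, ← Real.exp_add, ← Real.exp_add]
      congr 1; rw [hδ]; field_simp; ring
    -- This is where the critical exponent matters: `δ q = N - s` makes the coefficient of `w^(q-1)`
    -- independent of `t`.
    have e2 : Real.exp (-(δ * t)) * Real.exp ((N - 1) * t) * Real.exp t =
        Real.exp (s * t) * Real.exp ((q - 1) * (δ * t)) := by
      rw [← Real.exp_add, ← Real.exp_add, ← Real.exp_add]
      congr 1; linear_combination -t * hδq
    set X := f (Real.exp t) ^ (p - 1)
    set Y := f (Real.exp t) ^ (q - 1)
    have hep := (Real.exp_pos (p * t)).ne'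
    have hes := (Real.exp_pos (s * t)).ne'
    have e3 : Real.exp (-(δ * t)) * Real.exp ((N - 1) * t) * Real.exp t * (μ / Real.exp (p * t)) =
        μ * Real.exp ((p - 1) * (δ * t)) := by rw [e1]; field_simp
    have e4 : Real.exp (-(δ * t)) * Real.exp ((N - 1) * t) * Real.exp t * (Y / Real.exp (s * t)) =
        Y * Real.exp ((q - 1) * (δ * t)) := by rw [e2]; field_simp
    linear_combination (-X) * e3 - e4 - lam * X * e1
  · intro t ht
    exact mul_nonneg (Real.exp_pos _).le (hnonneg _ (hexp t ht))
  · intro a b hab hb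
    obtain ⟨r, hr, hfr⟩ := hdense (Real.exp a) (Real.exp b) (Real.exp_pos a).le
      (Real.exp_lt_exp.2 hab) ((Real.le_log_iff_exp_le hR).1 hb)
    have hr0 : 0 < r := (Real.exp_pos a).trans hr.1
    refine ⟨Real.log r, ⟨(Real.lt_log_iff_exp_lt hr0).2 hr.1, (Real.log_lt_iff_lt_exp hr0).2 hr.2⟩,
      ?_⟩
    rw [Real.exp_log hr0]
    exact mul_pos (Real.exp_pos _) hfr
  · have h1 : Tendsto (fun t => Real.exp (δ * t)) (𝓝[<] (Real.log R))
        (𝓝 (Real.exp (δ * Real.log R))) :=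
      (Continuous.tendsto (by fun_prop) _).mono_left nhdsWithin_le_nhds
    simpa using h1.mul (hf0.comp hlim)
  · obtain ⟨L, hL⟩ := hFL
    have h1 : Tendsto (fun t => Real.exp (-(δ * t))) (𝓝[<] (Real.log R))
        (𝓝 (Real.exp (-(δ * Real.log R)))) :=
      (Continuous.tendsto (by fun_prop) _).mono_left nhdsWithin_le_nhds
    exact ⟨_, h1.mul (hL.comp hlim)⟩
  · have himg : Real.exp '' Set.Iio (Real.log R) = Set.Ioo 0 R := by
      ext r
      constructor
      · rintro ⟨t, ht, rfl⟩
        exact hexp t ht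
      · intro hr
        exact ⟨Real.log r, Real.log_lt_log hr.1 hr.2, Real.exp_log hr.1⟩
    rw [← himg, integrableOn_image_iff_integrableOn_abs_deriv_smul measurableSet_Iio
      (fun t _ => (Real.hasDerivAt_exp t).hasDerivWithinAt) Real.exp_injective.injOn] at hint
    refine hint.congr_fun (fun t _ => ?_) measurableSet_Iio
    simp only [smul_eq_mul]
    rw [hP, abs_mul, abs_of_pos (Real.exp_pos _), abs_of_pos (Real.exp_pos _),
      Real.mul_rpow (Real.exp_pos _).le (abs_nonneg _), hrpow]
    have e : Real.exp t * Real.exp t ^ (N - 1) = Real.exp (p / (p - 1) * ((N - 1 - δ) * t)) := by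
      rw [hpow, ← Real.exp_add]
      congr 1; rw [hδ]; field_simp; ring
    rw [← e]
    ring

theorem theorem1p2 (N : ℕ) (p μ s R lam : ℝ) (hp : 1 < p) (hpN : p < N)
    (hμ : μ < ((N - p) / p) ^ p) (hs : 0 ≤ s) (hsp : s < p) (hR : 0 < R) :
    (lam ≤ 0 →
      ¬ ∃ u : EuclideanSpace ℝ (Fin N) → ℝ, IsPositiveRadialSolution p μ s lam R u) ∧
    (0 < lam →
      ∀ u v : EuclideanSpace ℝ (Fin N) → ℝ,
        IsPositiveRadialSolution p μ s lam R u → IsPositiveRadialSolution p μ s lam R v →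
          u =ᵐ[volume.restrict (Metric.ball (0 : EuclideanSpace ℝ (Fin N)) R)] v) := by
  have hδ : 0 < ((N : ℝ) - p) / p := div_pos (by linarith) (by linarith)
  -- The exponent is superlinear relative to `p` precisely because `N - s > N - p`.
  have hq : p < critExp N p s := by
    rw [critExp, lt_div_iff₀ (by linarith)]
    nlinarith
  have hN : 0 < N := by
    have : (0 : ℝ) < N := by linarith
    exact_mod_cast this
  have hnt : Nontrivial (EuclideanSpace ℝ (Fin N)) := by
    apply Module.nontrivial_of_finrank_pos (R := ℝ)
    rwa [finrank_euclideanSpace_fin]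
  refine ⟨?_, ?_⟩
  · rintro hl ⟨u, hu⟩
    obtain ⟨f, F, -, h1, h2, h3, h4, h5, h6⟩ := hu.exists_profile hp (hp.trans hq) hR
    exact (emdenFowler_of_profile hp hpN (hp.trans hq) hR h1 h2 h3 h4 h5 h6).not_of_lam_nonpos
      hp hδ hq hl
  · intro hl u v hu hv
    obtain ⟨f₁, F₁, hu, h1, h2, h3, h4, h5, h6⟩ := hu.exists_profile hp (hp.trans hq) hR
    obtain ⟨f₂, F₂, hv, k1, k2, k3, k4, k5, k6⟩ := hv.exists_profile hp (hp.trans hq) hR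
    have e₁ := emdenFowler_of_profile hp hpN (hp.trans hq) hR h1 h2 h3 h4 h5 h6
    have e₂ := emdenFowler_of_profile hp hpN (hp.trans hq) hR k1 k2 k3 k4 k5 k6
    have hx0 : ∀ᵐ x : EuclideanSpace ℝ (Fin N), x ≠ 0 := by simp [ae_iff]
    filter_upwards [hu, hv, ae_restrict_of_ae hx0, ae_restrict_mem measurableSet_ball]
      with x hux hvx hx hxB
    have hx' : 0 < ‖x‖ := norm_pos_iff.2 hx
    have hxR : ‖x‖ < R := by simpa using hxB
    have := e₁.eq_of_lam_pos e₂ hp hδ hq hl (Real.log_lt_log hx' hxR)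
    rw [Real.exp_log hx'] at this
    rw [hux, hvx, mul_left_cancel₀ (Real.exp_pos _).ne' this]
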